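/- Let $\gamma_t>0$, $\lambda_t>0$ and $\sigma_\varepsilon\ge 0$. Consider dimensions $d$ and sample sizes $n_t$ that tend to infinity with $d/n_t\to\gamma_t$. For each $(d,n_t)$ let $\beta_\star\sim\mathsf N(0,d^{-1}I_d)$, $x_1,\dots,x_{n_t}\sim\mathsf N(0,I_d)$ and $\varepsilon_1,\dots,\varepsilon_{n_t}\sim\mathsf N(0,\sigma_\varepsilon^2)$ all be independent, and let $y_i=\beta_\star^\top x_i+\varepsilon_i$. Let the teacher be the ridge regression estimator $$\hat\beta_t=\operatorname*{arg\,min}_{\beta\in\mathbb R^d}\Big[\frac1{n_t}\sum_{i=1}^{n_t}(y_i-\beta^\top x_i)^2+\lambda_t\|\beta\|_2^2\Big],$$ and let $\mathcal L_t=\mathbb E_{x,y}\,(y-\hat\beta_t^\top x)^2$ be its test error, where $x\sim\mathsf N(0,I_d)$, $y=\beta_\star^\top x+\varepsilon$, $\varepsilon\sim\mathsf N(0,\sigma_\varepsilon^2)$ is a fresh independent sample and the expectation is over $(x,\varepsilon)$ only, given $\beta_\star$ and the training data. Then $$\mathcal L_t\to_{\mathbb P}\ \sigma_\varepsilon^2+(\lambda_t-\sigma_\varepsilon^2\gamma_t)\,\lambda_t\,m_{t,2}+\sigma_\varepsilon^2\gamma_t\,m_{t,1}.$$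 Here $m_{t,1}=m(\lambda_t;\gamma_t)$ and $m_{t,2}=-\frac{\partial m}{\partial\lambda}(\lambda_t;\gamma_t)$, where $m(\lambda;\gamma)=\int\frac{d\mu_{\mathrm{MP}(\gamma)}(s)}{s+\lambda}$ is the Stieltjes transform, evaluated at $-\lambda$, of the Marchenko–Pastur law $\mu_{\mathrm{MP}(\gamma)}$ with parameter $\gamma$, i.e. the probability measure on $\mathbb R$ with an atom of mass $\max(1-1/\gamma,0)$ at $0$ and density $\frac{\sqrt{(b-s)(s-a)}}{2\pi\gamma s}$ on $[a,b]$, $a=(1-\sqrt\gamma)^2$, $b=(1+\sqrt\gamma)^2$. -/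

import Mathlib

open MeasureTheory ProbabilityTheory Filter Topology
open scoped NNReal

/-- The Marchenko–Pastur law with ratio parameter `γ > 0` (and unit variance): an atom of mass
`(1 - 1/γ)₊` at `0`, plus the density `√((b - x)(x - a)) / (2πγx)` on `[a, b]`, where
`a = (1 - √γ)²` and `b = (1 + √γ)²`. -/
noncomputable def marchenkoPastur (γ : ℝ) : Measure ℝ :=
  ENNReal.ofReal (1 - 1 / γ) • Measure.dirac 0 +
    volume.withDensity (fun x => ENNReal.ofReal
      ((Set.Icc ((1 - √γ) ^ 2) ((1 + √γ) ^ 2)).indicator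
        (fun x => √(((1 + √γ) ^ 2 - x) * (x - (1 - √γ) ^ 2)) / (2 * Real.pi * γ * x)) x))

/-- `m(λ; γ)`: the Stieltjes transform of the Marchenko–Pastur law evaluated at `-λ`. -/
noncomputable def mpStieltjes (lam γ : ℝ) : ℝ :=
  ∫ s, 1 / (s + lam) ∂(marchenkoPastur γ)

/-- `-∂m/∂λ`, evaluated at `(λ, γ)`. -/
noncomputable def mpStieltjesNegDeriv (lam γ : ℝ) : ℝ :=
  -deriv (fun l => mpStieltjes l γ) lam

/-- The law of `(β⋆, (x₁, …, xₙ), (ε₁, …, εₙ))`: all components are independent,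
`β⋆ ~ N(0, d⁻¹ I)`, `xᵢ ~ N(0, I)` in dimension `d`, and `εᵢ ~ N(0, σ²)`. -/
noncomputable def teacherLaw (d n : ℕ) (σ : ℝ≥0) :
    Measure (EuclideanSpace ℝ (Fin d) × (Fin n → EuclideanSpace ℝ (Fin d)) × (Fin n → ℝ)) :=
  (multivariateGaussian 0 ((d : ℝ)⁻¹ • (1 : Matrix (Fin d) (Fin d) ℝ))).prod
    ((Measure.pi fun _ => stdGaussian (EuclideanSpace ℝ (Fin d))).prod
      (Measure.pi fun _ => gaussianReal 0 (σ ^ 2)))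

/-- The label `y = βᵀ x + ε`. -/
noncomputable def linearLabel {d : ℕ} (β x : EuclideanSpace ℝ (Fin d)) (ε : ℝ) : ℝ :=
  inner ℝ β x + ε

/-- The ridge objective `n⁻¹ ∑ᵢ (yᵢ - βᵀ xᵢ)² + λ ‖β‖²`. -/
noncomputable def ridgeObjective {d n : ℕ} (lam : ℝ) (x : Fin n → EuclideanSpace ℝ (Fin d))
    (y : Fin n → ℝ) (β : EuclideanSpace ℝ (Fin d)) : ℝ :=
  1 / (n : ℝ) * ∑ i, (y i - inner ℝ β (x i)) ^ 2 + lam * ‖β‖ ^ 2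

/-- The test error `E_{x,y} (y - βhatᵀ x)²` of the linear predictor `βhat` when the target vector
is `β`: here `y = βᵀ x + ε` with `x ~ N(0, I)` and `ε ~ N(0, σ²)` independent, and the
expectation is over the fresh sample `(x, ε)` only. -/
noncomputable def testError {d : ℕ} (σ : ℝ≥0) (β βhat : EuclideanSpace ℝ (Fin d)) : ℝ :=
  ∫ z, (linearLabel β z.1 z.2 - inner ℝ βhat z.1) ^ 2
    ∂((stdGaussian (EuclideanSpace ℝ (Fin d))).prod (gaussianReal 0 (σ ^ 2)))

/-- Convergence in probability of real random variables `Z k`, each on its own probability space,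
to a constant `c`. -/
def TendstoInProbabilityConst {Ω : ℕ → Type*} [∀ k, MeasurableSpace (Ω k)]
    (P : ∀ k, Measure (Ω k)) (Z : ∀ k, Ω k → ℝ) (c : ℝ) : Prop :=
  ∀ δ : ℝ, 0 < δ → Tendsto (fun k => P k {ω | δ ≤ |Z k ω - c|}) atTop (𝓝 0)

/-! Write A = λI + n⁻¹ ∑ xᵢxᵢᵀ. The normal equations read A(β⋆ − β̂) = λβ⋆ − n⁻¹ ∑ εᵢxᵢ, and the
test error is σ² + ‖β⋆ − β̂‖². Given the covariates, β⋆ − β̂ is a linear image Tz of one standard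
Gaussian vector z in dimension d + n, with TTᵀ = (λ²/d − σ²λ/n)A⁻² + (σ²/n)A⁻¹. Hence ‖Tz‖² has mean
tr TTᵀ and variance proportional to tr (TTᵀ)², which is O(1/d) uniformly in the covariates
(`lintegral_quadForm_stdGaussian`, `lintegral_ridgeRisk_sub_trace_le`). It remains to find the
limits of tr A⁻¹/d and tr A⁻²/d.

For the first, let Bᵢ be A without its i-th sample. Expanding d = tr(A⁻¹A) and applying
Sherman–Morrison gives λ tr A⁻¹ + ∑ qᵢ/(1 + qᵢ) = d with qᵢ = n⁻¹ xᵢᵀBᵢ⁻¹xᵢ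
(`trace_inv_regGram_add_sum_looQuad`). Since xᵢ is independent of Bᵢ, qᵢ concentrates at n⁻¹ tr
Bᵢ⁻¹, which differs from n⁻¹ tr A⁻¹ by at most 1/(nλ). So g = tr A⁻¹/d nearly solves λg + g/(1 +
(d/n)g) = 1, an equation whose nonnegative root is stable (`mul_abs_sub_mpRoot_le`). An explicit
integration identifies the root with the Marchenko–Pastur Stieltjes transform
(`mpStieltjes_eq_mpRoot`).

For the second, tr A⁻² is minus the λ-derivative of tr A⁻¹, and a difference quotient of step h
approximates it, after division by d, within h/λ³ for every sample; so the limit is minus the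
derivative of the first one. -/

/-! ### Closed form of the Marchenko–Pastur Stieltjes transform -/

/-- With Q = (b − t)(t − a), one minus the square of either arcsin argument is a perfect square
multiple of Q, so the three terms contribute ((a + b)/2 − t)/√Q, ((a + b)/2)/√Q and −(ab/t)/√Q,
which add up to (Q/t)/√Q. -/
lemma hasDerivAt_semicircle_div {a b t : ℝ} (ha : 0 ≤ a) (hat : a < t) (htb : t < b) :
    HasDerivAt (fun t => √((b - t) * (t - a)) + (a + b) / 2 * Real.arcsin ((2 * t - a - b) / (b - a))
      - √(a * b) * Real.arcsin (((a + b) * t - 2 * (a * b)) / ((b - a) * t)))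
      (√((b - t) * (t - a)) / t) t := by
  have ht : 0 < t := by linarith
  have hba : 0 < b - a := by linarith
  have hQ : 0 < (b - t) * (t - a) := mul_pos (by linarith) (by linarith)
  have hsQ : 0 < √((b - t) * (t - a)) := Real.sqrt_pos.2 hQ
  have hsq : √((b - t) * (t - a)) ^ 2 = (b - t) * (t - a) := Real.sq_sqrt hQ.le
  have h1 : HasDerivAt (fun t => √((b - t) * (t - a)))
      ((a + b - 2 * t) / (2 * √((b - t) * (t - a)))) t := by
    have := (((hasDerivAt_id t).const_sub b).mul ((hasDerivAt_id t).sub_const a)).sqrt hQ.ne'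
    refine this.congr_deriv ?_
    simp only [id, Pi.mul_apply]
    congr 1; ring
  have hu : 1 - ((2 * t - a - b) / (b - a)) ^ 2 = (2 * √((b - t) * (t - a)) / (b - a)) ^ 2 := by
    field_simp
    rw [hsq]; ring
  have hune : (2 * t - a - b) / (b - a) ≠ -1 ∧ (2 * t - a - b) / (b - a) ≠ 1 := by
    constructor
    · intro h
      rw [div_eq_iff hba.ne'] at h
      linarith
    · intro h
      rw [div_eq_iff hba.ne'] at h
      linarith
  have h2 : HasDerivAt (fun t => Real.arcsin ((2 * t - a - b) / (b - a)))
      (1 / √((b - t) * (t - a))) t := by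
    have hlin : HasDerivAt (fun t : ℝ => (2 * t - a - b) / (b - a)) (2 / (b - a)) t := by
      have := ((((hasDerivAt_id t).const_mul 2).sub_const a).sub_const b).div_const (b - a)
      simpa using this
    have := (Real.hasDerivAt_arcsin hune.1 hune.2).comp t hlin
    refine this.congr_deriv ?_
    rw [hu, Real.sqrt_sq (by positivity)]
    field_simp
  rcases ha.eq_or_lt with rfl | ha
  -- For a = 0 (the case γ = 1) the last arcsin has argument 1, where it is not differentiable, but
  -- its coefficient √(ab) vanishes.
  · have h3 := h1.add (h2.const_mul ((0 + b) / 2))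
    simp only [zero_mul, Real.sqrt_zero, sub_zero, zero_add] at h3 hsq ⊢
    refine h3.congr_deriv ?_
    simp only [sub_zero] at hsQ
    generalize √((b - t) * t) = R at hsQ hsq
    field_simp
    rw [hsq]; ring
  · have hb : 0 < b := by linarith
    have hab : 0 < √(a * b) := Real.sqrt_pos.2 (by positivity)
    have hsab : √(a * b) ^ 2 = a * b := Real.sq_sqrt (by positivity)
    have hv : 1 - (((a + b) * t - 2 * (a * b)) / ((b - a) * t)) ^ 2
        = (2 * √(a * b) * √((b - t) * (t - a)) / ((b - a) * t)) ^ 2 := by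
      field_simp
      rw [hsq, hsab]; ring
    have hvne : ((a + b) * t - 2 * (a * b)) / ((b - a) * t) ≠ -1 ∧
        ((a + b) * t - 2 * (a * b)) / ((b - a) * t) ≠ 1 := by
      constructor
      · intro h
        rw [div_eq_iff (by positivity)] at h
        have : 2 * b * (t - a) = 0 := by linarith
        have : 0 < 2 * b * (t - a) := mul_pos (by linarith) (by linarith)
        linarith
      · intro h
        rw [div_eq_iff (by positivity)] at h
        have : 2 * a * (b - t) = 0 := by linarith
        have : 0 < 2 * a * (b - t) := mul_pos (by linarith) (by linarith)
        linarith
    have h3 : HasDerivAt (fun t => Real.arcsin (((a + b) * t - 2 * (a * b)) / ((b - a) * t)))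
        (√(a * b) / (t * √((b - t) * (t - a)))) t := by
      have hlin : HasDerivAt (fun t : ℝ => ((a + b) * t - 2 * (a * b)) / ((b - a) * t))
          (2 * (a * b) / ((b - a) * t ^ 2)) t := by
        have := (((hasDerivAt_id t).const_mul (a + b)).sub_const (2 * (a * b))).div
          ((hasDerivAt_id t).const_mul (b - a)) (mul_pos hba ht).ne'
        refine this.congr_deriv ?_
        simp only [id]
        field_simp
        ring
      have := (Real.hasDerivAt_arcsin hvne.1 hvne.2).comp t hlin
      refine this.congr_deriv ?_
      rw [hv, Real.sqrt_sq (by positivity)]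
      field_simp
      rw [hsab]
    refine ((h1.add (h2.const_mul ((a + b) / 2))).sub (h3.const_mul √(a * b))).congr_deriv ?_
    field_simp
    rw [hsab, hsq]; ring

lemma continuousOn_semicircle_div_primitive {a b : ℝ} (ha : 0 ≤ a) (hab : a < b) :
    ContinuousOn (fun t => √((b - t) * (t - a)) +
        (a + b) / 2 * Real.arcsin ((2 * t - a - b) / (b - a))
      - √(a * b) * Real.arcsin (((a + b) * t - 2 * (a * b)) / ((b - a) * t))) (Set.Icc a b) := by
  have h12 : Continuous (fun t => √((b - t) * (t - a)) +
        (a + b) / 2 * Real.arcsin ((2 * t - a - b) / (b - a))) := by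
    fun_prop
  refine h12.continuousOn.sub ?_
  rcases ha.eq_or_lt with rfl | ha
  · simpa using continuousOn_const
  · refine continuousOn_const.mul (Real.continuous_arcsin.comp_continuousOn ?_)
    refine ContinuousOn.div (by fun_prop) (by fun_prop) fun t ht => ?_
    have := ht.1
    exact (mul_pos (by linarith) (by linarith)).ne'

/-- For a = 0 the integrand is unbounded near 0; integrability comes from its being a nonnegative
derivative of a continuous primitive. -/
lemma intervalIntegrable_semicircle_div {a b : ℝ} (ha : 0 ≤ a) (hab : a < b) :
    IntervalIntegrable (fun t => √((b - t) * (t - a)) / t) volume a b :=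
  intervalIntegral.intervalIntegrable_deriv_of_nonneg
    (by simpa [Set.uIcc_of_le hab.le] using continuousOn_semicircle_div_primitive ha hab)
    (fun t ht => by
      simp only [min_eq_left hab.le, max_eq_right hab.le] at ht
      exact hasDerivAt_semicircle_div ha ht.1 ht.2)
    (fun t ht => by
      simp only [min_eq_left hab.le] at ht
      exact div_nonneg (Real.sqrt_nonneg _) (by linarith [ht.1]))

lemma integral_semicircle_div {a b : ℝ} (ha : 0 ≤ a) (hab : a < b) :
    ∫ t in a..b, √((b - t) * (t - a)) / t = Real.pi * ((a + b) / 2 - √(a * b)) := by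
  rw [intervalIntegral.integral_eq_sub_of_hasDerivAt_of_le hab.le
    (continuousOn_semicircle_div_primitive ha hab)
    (fun t ht => hasDerivAt_semicircle_div ha ht.1 ht.2) (intervalIntegrable_semicircle_div ha hab)]
  have hba : b - a ≠ 0 := by linarith
  have hb : b ≠ 0 := by linarith
  have e1 : (2 * b - a - b) / (b - a) = 1 := by rw [div_eq_one_iff_eq hba]; ring
  have e2 : (2 * a - a - b) / (b - a) = -1 := by rw [div_eq_iff hba]; ring
  have e3 : ((a + b) * b - 2 * (a * b)) / ((b - a) * b) = 1 := by
    rw [div_eq_one_iff_eq (mul_ne_zero hba hb)]; ring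
  rw [e1, e2, e3]
  rcases ha.eq_or_lt with rfl | ha
  · simp
    ring
  · have e4 : ((a + b) * a - 2 * (a * b)) / ((b - a) * a) = -1 := by
      rw [div_eq_iff (mul_ne_zero hba ha.ne')]; ring
    rw [e4]
    simp
    ring

lemma intervalIntegrable_semicircle_div_add {a b lam : ℝ} (ha : 0 ≤ a + lam) (hab : a < b) :
    IntervalIntegrable (fun s => √((b - s) * (s - a)) / (s + lam)) volume a b := by
  have := (intervalIntegrable_semicircle_div ha (add_lt_add_left hab lam)).comp_add_right lam
  simpa [add_sub_add_right_eq_sub] using this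

lemma integral_semicircle_div_add {a b lam : ℝ} (ha : 0 ≤ a + lam) (hab : a < b) :
    ∫ s in a..b, √((b - s) * (s - a)) / (s + lam) =
      Real.pi * ((a + b) / 2 + lam - √((a + lam) * (b + lam))) := by
  have h := intervalIntegral.integral_comp_add_right (a := a) (b := b)
    (fun t => √((b + lam - t) * (t - (a + lam))) / t) lam
  rw [integral_semicircle_div ha (add_lt_add_left hab lam)] at h
  simp only [add_sub_add_right_eq_sub] at h
  rw [h]
  ring

/-- The closed form of the Stieltjes transform of the Marchenko–Pastur law at `-lam`. -/
noncomputable def mpRoot (lam γ : ℝ) : ℝ :=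
  (γ - 1 - lam + √((1 - γ + lam) ^ 2 + 4 * γ * lam)) / (2 * γ * lam)

lemma mpRoot_nonneg {lam γ : ℝ} (hlam : 0 < lam) (hγ : 0 < γ) : 0 ≤ mpRoot lam γ := by
  refine div_nonneg ?_ (by positivity)
  have : |1 - γ + lam| ≤ √((1 - γ + lam) ^ 2 + 4 * γ * lam) :=
    Real.abs_le_sqrt (by nlinarith [mul_pos hγ hlam])
  linarith [le_abs_self (1 - γ + lam)]

/-- Clearing denominators gives γλm² + (λ + 1 − γ)m − 1 = 0, of which `mpRoot` is the root with the
plus sign. -/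
lemma mpRoot_fixed_point {lam γ : ℝ} (hlam : 0 < lam) (hγ : 0 < γ) :
    lam * mpRoot lam γ + mpRoot lam γ / (1 + γ * mpRoot lam γ) = 1 := by
  have h0 := mpRoot_nonneg hlam hγ
  have hD : 0 ≤ (1 - γ + lam) ^ 2 + 4 * γ * lam := by positivity
  have hq : γ * lam * mpRoot lam γ ^ 2 + (lam + 1 - γ) * mpRoot lam γ - 1 = 0 := by
    have hs := Real.sq_sqrt hD
    unfold mpRoot
    generalize √((1 - γ + lam) ^ 2 + 4 * γ * lam) = S at hs
    field_simp
    linear_combination hs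
  have : 0 < 1 + γ * mpRoot lam γ := by positivity
  field_simp
  linear_combination hq

/-- Needed because at finite size the ratio is d/n rather than γ. -/
lemma continuousAt_mpRoot {lam γ : ℝ} (hlam : 0 < lam) (hγ : 0 < γ) :
    ContinuousAt (fun g => mpRoot lam g) γ := by
  unfold mpRoot
  refine ContinuousAt.div (by fun_prop) (by fun_prop) (by positivity)

lemma differentiableAt_mpRoot {lam γ : ℝ} (hlam : 0 < lam) (hγ : 0 < γ) :
    DifferentiableAt ℝ (fun l => mpRoot l γ) lam := by
  unfold mpRoot
  have : (1 - γ + lam) ^ 2 + 4 * γ * lam ≠ 0 := by positivity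
  refine DifferentiableAt.div ?_ (by fun_prop) (by positivity)
  exact DifferentiableAt.add (by fun_prop) (DifferentiableAt.sqrt (by fun_prop) this)

lemma mpStieltjes_eq_mpRoot {lam γ : ℝ} (hlam : 0 < lam) (hγ : 0 < γ) :
    mpStieltjes lam γ = mpRoot lam γ := by
  set a := (1 - √γ) ^ 2 with ha_def
  set b := (1 + √γ) ^ 2 with hb_def
  have hsγ : 0 < √γ := Real.sqrt_pos.2 hγ
  have hsq : √γ ^ 2 = γ := Real.sq_sqrt hγ.le
  have ha : 0 ≤ a := sq_nonneg _
  have hab : a < b := by rw [ha_def, hb_def]; nlinarith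
  have hsum : a + b = 2 * (1 + γ) := by rw [ha_def, hb_def]; linear_combination 2 * hsq
  have hprod : a * b = (1 - γ) ^ 2 := by
    rw [ha_def, hb_def, ← mul_pow]
    congr 1
    linear_combination -hsq
  set ρ : ℝ → ℝ := fun x => (Set.Icc a b).indicator
    (fun x => √((b - x) * (x - a)) / (2 * Real.pi * γ * x)) x with hρ
  have hρ0 : ∀ x, 0 ≤ ρ x := fun x => Set.indicator_nonneg (fun y hy => by
    have : 0 ≤ y := ha.trans hy.1
    positivity) x
  have hρm : Measurable ρ := by
    refine Measurable.indicator ?_ measurableSet_Icc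
    fun_prop
  -- Partial fractions for 1/(s(s + λ)); the `s + 0` matches the shifted integral with shift 0. At s
  -- = 0, which forces a = 0, the square root vanishes and both sides are 0.
  have hfun : (fun s => (ENNReal.ofReal (ρ s)).toReal • (1 / (s + lam))) =
      (Set.Icc a b).indicator (fun s => (2 * Real.pi * γ * lam)⁻¹ *
        (√((b - s) * (s - a)) / (s + 0) - √((b - s) * (s - a)) / (s + lam))) := by
    funext s
    rw [ENNReal.toReal_ofReal (hρ0 s), smul_eq_mul]
    by_cases hs : s ∈ Set.Icc a b
    · simp only [hρ, Set.indicator_of_mem hs]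
      have hs0 : 0 ≤ s := ha.trans hs.1
      rcases hs0.eq_or_lt with h0 | h0
      · have : s - a = 0 := by linarith [hs.1]
        simp [this]
      · have : 0 < s + lam := by linarith
        field_simp
        ring
    · simp [hρ, Set.indicator_of_notMem hs]
  have hI0 := intervalIntegrable_semicircle_div_add (lam := 0) (by simpa using ha) hab
  have hI1 := intervalIntegrable_semicircle_div_add (lam := lam) (by positivity) hab
  have hint : IntegrableOn (fun s => (2 * Real.pi * γ * lam)⁻¹ *
        (√((b - s) * (s - a)) / (s + 0) - √((b - s) * (s - a)) / (s + lam))) (Set.Icc a b) :=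
    (intervalIntegrable_iff_integrableOn_Icc_of_le hab.le).1 ((hI0.sub hI1).const_mul _)
  have hc : Integrable (fun s => 1 / (s + lam))
      (volume.withDensity fun x => ENNReal.ofReal (ρ x)) := by
    rw [integrable_withDensity_iff_integrable_smul' (by fun_prop) (by simp), hfun]
    exact hint.integrable_indicator measurableSet_Icc
  have hdirac : Integrable (fun s => 1 / (s + lam))
      (ENNReal.ofReal (1 - 1 / γ) • Measure.dirac (0 : ℝ)) := by
    refine Integrable.smul_measure ?_ ENNReal.ofReal_ne_top
    exact integrable_dirac (by simp)
  have key : mpStieltjes lam γ = max (1 - 1 / γ) 0 * (1 / lam) + (2 * Real.pi * γ * lam)⁻¹ *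
      (Real.pi * ((a + b) / 2 + 0 - √((a + 0) * (b + 0))) -
        Real.pi * ((a + b) / 2 + lam - √((a + lam) * (b + lam)))) := by
    rw [← integral_semicircle_div_add (lam := 0) (by simpa using ha) hab,
      ← integral_semicircle_div_add (lam := lam) (by positivity) hab,
      ← intervalIntegral.integral_sub hI0 hI1, ← intervalIntegral.integral_const_mul,
      intervalIntegral.integral_of_le hab.le, ← integral_Icc_eq_integral_Ioc,
      ← integral_indicator measurableSet_Icc, ← hfun]
    unfold mpStieltjes marchenkoPastur
    rw [integral_add_measure hdirac hc, integral_smul_measure, integral_dirac,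
      integral_withDensity_eq_integral_toReal_smul (by fun_prop) (by simp)]
    simp [ENNReal.toReal_ofReal', hρ]
  have h1 : √((a + 0) * (b + 0)) = |1 - γ| := by
    rw [add_zero, add_zero, hprod, Real.sqrt_sq_eq_abs]
  have h2 : (a + lam) * (b + lam) = (1 - γ + lam) ^ 2 + 4 * γ * lam := by
    linear_combination hprod + lam * hsum
  -- The mass of the atom is written with |1 − γ| = √(ab) so that it cancels the same term coming
  -- from the density.
  have h3 : max (1 - 1 / γ) 0 = (|1 - γ| + γ - 1) / (2 * γ) := by
    rcases le_total γ 1 with h | h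
    · rw [abs_of_nonneg (by linarith), max_eq_right]
      · ring
      · rw [sub_nonpos, le_div_iff₀ hγ]; linarith
    · rw [abs_of_nonpos (by linarith), max_eq_left]
      · field_simp; ring
      · rw [sub_nonneg, div_le_iff₀ hγ]; linarith
  rw [key, h1, h2, h3, hsum, mpRoot]
  have := Real.pi_pos
  field_simp
  ring

lemma mpStieltjesNegDeriv_eq {lam γ : ℝ} (hlam : 0 < lam) (hγ : 0 < γ) :
    mpStieltjesNegDeriv lam γ = -deriv (fun l => mpRoot l γ) lam := by
  unfold mpStieltjesNegDeriv
  rw [Filter.EventuallyEq.deriv_eq]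
  filter_upwards [lt_mem_nhds hlam] with l hl
  exact mpStieltjes_eq_mpRoot hl hγ

/-! ### Variance of Gaussian quadratic forms -/

open scoped Matrix in
lemma Matrix.IsHermitian.trace_mul_self_eq_sum {ι : Type*} [Fintype ι] [DecidableEq ι]
    {M : Matrix ι ι ℝ} (hM : M.IsHermitian) :
    (M * M).trace = ∑ i, hM.eigenvalues i ^ 2 := by
  conv_lhs => rw [hM.spectral_theorem]
  rw [← map_mul, Unitary.conjStarAlgAut_apply, Matrix.trace_mul_cycle]
  simp [Matrix.trace, pow_two]

open scoped Matrix in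
lemma Matrix.IsHermitian.dotProduct_mulVec_sum_eigenvectorBasis {ι : Type*} [Fintype ι]
    [DecidableEq ι] {M : Matrix ι ι ℝ} (hM : M.IsHermitian) (z : ι → ℝ) :
    (∑ i, z i • hM.eigenvectorBasis i).ofLp ⬝ᵥ M *ᵥ (∑ i, z i • hM.eigenvectorBasis i).ofLp =
      ∑ i, hM.eigenvalues i * z i ^ 2 := by
  have h1 : M *ᵥ (∑ i, z i • hM.eigenvectorBasis i).ofLp =
      (∑ i, (z i * hM.eigenvalues i) • hM.eigenvectorBasis i).ofLp := by
    simp only [WithLp.ofLp_sum, WithLp.ofLp_smul, Matrix.mulVec_sum, Matrix.mulVec_smul,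
      hM.mulVec_eigenvectorBasis, smul_smul]
  have h2 : ∀ u v : EuclideanSpace ℝ ι, u.ofLp ⬝ᵥ v.ofLp = inner ℝ u v := fun u v => by
    rw [EuclideanSpace.inner_eq_star_dotProduct, dotProduct_comm]; simp
  rw [h1, h2, hM.eigenvectorBasis.orthonormal.inner_sum]
  refine Finset.sum_congr rfl fun i _ => ?_
  simp; ring

/-- The variance of the square of a standard Gaussian variable. -/
noncomputable def gaussianSqVar : ℝ := Var[fun x => x ^ 2; gaussianReal 0 1]

lemma gaussianSqVar_nonneg : 0 ≤ gaussianSqVar := variance_nonneg _ _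

lemma memLp_sq_gaussianReal : MemLp (fun x : ℝ => x ^ 2) 2 (gaussianReal 0 1) := by
  have h : MemLp (fun x : ℝ => x) 4 (gaussianReal 0 1) :=
    memLp_id_gaussianReal' 4 (by simp)
  have := h.norm_rpow_div 2
  simp only [Real.norm_eq_abs, ENNReal.toReal_ofNat] at this
  have h42 : (4 : ENNReal) / 2 = 2 := by
    rw [show (4 : ENNReal) = 2 * 2 by norm_num]
    exact ENNReal.mul_div_cancel_right (by simp) (by simp)
  rw [h42] at this
  simpa using this

lemma integral_sq_gaussianReal (v : ℝ≥0) : ∫ x, x ^ 2 ∂(gaussianReal 0 v) = v := by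
  have := variance_fun_id_gaussianReal (μ := 0) (v := v)
  rwa [variance_of_integral_eq_zero (by fun_prop) (by simp)] at this

/-- Variances of independent summands add. The constant `gaussianSqVar` is never evaluated: only its
independence of the dimension matters. -/
lemma lintegral_weighted_sq_gaussian {ι : Type*} [Fintype ι] (w : ι → ℝ) :
    ∫⁻ z, ENNReal.ofReal ((∑ i, w i * z i ^ 2 - ∑ i, w i) ^ 2)
      ∂(Measure.pi fun _ : ι => gaussianReal 0 1) =
      ENNReal.ofReal (gaussianSqVar * ∑ i, w i ^ 2) := by
  have hL : ∀ i, MemLp (fun x : ℝ => w i * x ^ 2) 2 (gaussianReal 0 1) :=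
    fun i => memLp_sq_gaussianReal.const_mul _
  have hLpi : ∀ i, MemLp (fun z : ι → ℝ => w i * z i ^ 2) 2
      (Measure.pi fun _ : ι => gaussianReal 0 1) := fun i =>
    (hL i).comp_measurePreserving (measurePreserving_eval (fun _ : ι => gaussianReal 0 1) i)
  have hvar := variance_sum_pi (μ := fun _ : ι => gaussianReal 0 1)
    (X := fun i x => w i * x ^ 2) hL
  have hsum : (∑ i, fun z : ι → ℝ => w i * z i ^ 2) = fun z => ∑ i, w i * z i ^ 2 := by
    ext z; simp
  have hmem : MemLp (fun z : ι → ℝ => ∑ i, w i * z i ^ 2) 2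
      (Measure.pi fun _ : ι => gaussianReal 0 1) := memLp_finsetSum _ fun i _ => hLpi i
  have hmean : ∫ z, ∑ i, w i * z i ^ 2 ∂(Measure.pi fun _ : ι => gaussianReal 0 1) = ∑ i, w i := by
    rw [integral_finsetSum _ fun i _ => (hLpi i).integrable (by norm_num)]
    refine Finset.sum_congr rfl fun i _ => ?_
    have := integral_comp_eval (X := fun _ : ι => ℝ) (μ := fun _ : ι => gaussianReal 0 1) (i := i)
      (f := fun x : ℝ => x ^ 2) (by fun_prop)
    rw [integral_const_mul, this, integral_sq_gaussianReal]
    simp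
  rw [hsum] at hvar
  simp_rw [variance_const_mul] at hvar
  rw [← hmean, ← evariance_eq_lintegral_ofReal, ← ofReal_variance hmem, hvar, gaussianSqVar,
    ← Finset.sum_mul, mul_comm]

open scoped Matrix in
/-- The variance of a quadratic form in a standard Gaussian vector. -/
lemma lintegral_quadForm_stdGaussian {ι : Type*} [Fintype ι] [DecidableEq ι]
    {M : Matrix ι ι ℝ} (hM : M.IsHermitian) :
    ∫⁻ v, ENNReal.ofReal ((v.ofLp ⬝ᵥ M *ᵥ v.ofLp - M.trace) ^ 2)
      ∂(stdGaussian (EuclideanSpace ℝ ι)) = ENNReal.ofReal (gaussianSqVar * (M * M).trace) := by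
  -- By rotation invariance the Gaussian vector may be generated in the eigenbasis of M, where the
  -- form is a weighted sum of squares.
  rw [stdGaussian_eq_map_pi_orthonormalBasis hM.eigenvectorBasis, lintegral_map]
  · simp_rw [hM.dotProduct_mulVec_sum_eigenvectorBasis, hM.trace_mul_self_eq_sum,
      hM.trace_eq_sum_eigenvalues]
    exact lintegral_weighted_sq_gaussian _
  · have : Continuous fun v : EuclideanSpace ℝ ι => (v.ofLp ⬝ᵥ M *ᵥ v.ofLp - M.trace) ^ 2 := by
      fun_prop
    exact this.measurable.ennreal_ofReal
  · fun_prop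

/-! ### Inverses of coercive matrices, shifts and rank-one perturbations -/

section CoerciveMatrix

open scoped Matrix

/-- A real symmetric matrix whose quadratic form is bounded below by `lam ‖v‖²`. -/
structure IsCoerciveMatrix {κ : Type*} [Fintype κ] (lam : ℝ) (A : Matrix κ κ ℝ) : Prop where
  isHermitian : A.IsHermitian
  coercive : ∀ v, lam * (v ⬝ᵥ v) ≤ v ⬝ᵥ A *ᵥ v

lemma dotProduct_self_nonneg_real {κ : Type*} [Fintype κ] (v : κ → ℝ) : 0 ≤ v ⬝ᵥ v :=
  Finset.sum_nonneg fun i _ => mul_self_nonneg (v i)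

lemma Matrix.IsHermitian.dotProduct_mulVec_comm {κ : Type*} [Fintype κ] {P : Matrix κ κ ℝ}
    (hP : P.IsHermitian) (u v : κ → ℝ) : u ⬝ᵥ P *ᵥ v = (P *ᵥ u) ⬝ᵥ v := by
  rw [Matrix.dotProduct_mulVec, ← Matrix.mulVec_transpose]
  have : Pᵀ = P := by simpa using hP.eq
  rw [this]

lemma Matrix.trace_eq_sum_dotProduct_single {κ : Type*} [Fintype κ] [DecidableEq κ]
    (P : Matrix κ κ ℝ) :
    P.trace = ∑ j, (Pi.single j 1 : κ → ℝ) ⬝ᵥ P *ᵥ (Pi.single j 1 : κ → ℝ) := by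
  simp [Matrix.trace]

/-- Transfers pointwise bounds on the quadratic form of Q to bounds on traces, one column of P at a
time. -/
lemma Matrix.IsHermitian.trace_conj_eq_sum {κ : Type*} [Fintype κ] [DecidableEq κ]
    {P : Matrix κ κ ℝ} (hP : P.IsHermitian) (Q : Matrix κ κ ℝ) :
    (P * Q * P).trace =
      ∑ j, (P *ᵥ Pi.single j (1 : ℝ)) ⬝ᵥ Q *ᵥ (P *ᵥ Pi.single j (1 : ℝ)) := by
  rw [Matrix.trace_eq_sum_dotProduct_single]
  refine Finset.sum_congr rfl fun j _ => ?_
  rw [← Matrix.mulVec_mulVec, ← Matrix.mulVec_mulVec, hP.dotProduct_mulVec_comm]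

namespace IsCoerciveMatrix

variable {κ : Type*} [Fintype κ] {lam : ℝ} {A : Matrix κ κ ℝ}

lemma posDef (hA : IsCoerciveMatrix lam A) (hlam : 0 < lam) : A.PosDef := by
  refine Matrix.PosDef.of_dotProduct_mulVec_pos hA.isHermitian fun v hv => ?_
  have h1 : 0 < v ⬝ᵥ v := by
    refine (dotProduct_self_nonneg_real v).lt_of_ne fun h => hv ?_
    exact dotProduct_self_eq_zero.1 h.symm
  have := hA.coercive v
  simp only [star_trivial]
  nlinarith

lemma mono {μ : ℝ} (hA : IsCoerciveMatrix lam A) (hμ : μ ≤ lam) : IsCoerciveMatrix μ A where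
  isHermitian := hA.isHermitian
  coercive v := (mul_le_mul_of_nonneg_right hμ (dotProduct_self_nonneg_real v)).trans
    (hA.coercive v)

lemma add_rankOne {B : Matrix κ κ ℝ} {c : ℝ} {x : κ → ℝ} (hB : IsCoerciveMatrix lam B)
    (hc : 0 ≤ c) :
    IsCoerciveMatrix lam (B + c • Matrix.vecMulVec x x) where
  isHermitian := hB.isHermitian.add (by
    ext i j
    simp [Matrix.vecMulVec_apply, mul_comm])
  coercive v := by
    have := hB.coercive v
    rw [Matrix.add_mulVec, dotProduct_add, Matrix.smul_mulVec, Matrix.vecMulVec_mulVec,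
      dotProduct_smul]
    simp only [op_smul_eq_smul, dotProduct_smul, smul_eq_mul, dotProduct_comm v x]
    have : 0 ≤ c * ((x ⬝ᵥ v) * (x ⬝ᵥ v)) := mul_nonneg hc (mul_self_nonneg _)
    linarith

variable [DecidableEq κ]

lemma isUnit_det (hA : IsCoerciveMatrix lam A) (hlam : 0 < lam) : IsUnit A.det :=
  (Matrix.isUnit_iff_isUnit_det _).1 (hA.posDef hlam).isUnit

lemma inv_isHermitian (hA : IsCoerciveMatrix lam A) : A⁻¹.IsHermitian :=
  hA.isHermitian.inv

lemma mulVec_inv_mulVec (hA : IsCoerciveMatrix lam A) (hlam : 0 < lam) (v : κ → ℝ) :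
    A *ᵥ (A⁻¹ *ᵥ v) = v := by
  rw [Matrix.mulVec_mulVec, Matrix.mul_nonsing_inv _ (hA.isUnit_det hlam), Matrix.one_mulVec]

lemma inv_mulVec_eq (hA : IsCoerciveMatrix lam A) (hlam : 0 < lam) {u v : κ → ℝ}
    (h : A *ᵥ u = v) : A⁻¹ *ᵥ v = u := by
  rw [← h, Matrix.mulVec_mulVec, Matrix.nonsing_inv_mul _ (hA.isUnit_det hlam), Matrix.one_mulVec]

lemma mul_dotProduct_inv_le (hA : IsCoerciveMatrix lam A) (hlam : 0 < lam) (v : κ → ℝ) :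
    lam * ((A⁻¹ *ᵥ v) ⬝ᵥ (A⁻¹ *ᵥ v)) ≤ v ⬝ᵥ A⁻¹ *ᵥ v := by
  have := hA.coercive (A⁻¹ *ᵥ v)
  rwa [hA.mulVec_inv_mulVec hlam, dotProduct_comm _ v] at this

lemma dotProduct_inv_nonneg (hA : IsCoerciveMatrix lam A) (hlam : 0 < lam) (v : κ → ℝ) :
    0 ≤ v ⬝ᵥ A⁻¹ *ᵥ v :=
  (mul_nonneg hlam.le (dotProduct_self_nonneg_real _)).trans (hA.mul_dotProduct_inv_le hlam v)

lemma dotProduct_inv_le (hA : IsCoerciveMatrix lam A) (hlam : 0 < lam) (v : κ → ℝ) :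
    v ⬝ᵥ A⁻¹ *ᵥ v ≤ (v ⬝ᵥ v) / lam := by
  have h1 := hA.mul_dotProduct_inv_le hlam v
  -- Expanding this square and using λ‖A⁻¹v‖² ≤ vᵀA⁻¹v leaves λ vᵀA⁻¹v ≤ ‖v‖².
  have h2 := dotProduct_self_nonneg_real (lam • (A⁻¹ *ᵥ v) - v)
  simp only [sub_dotProduct, dotProduct_sub, smul_dotProduct, dotProduct_smul, smul_eq_mul,
    dotProduct_comm (A⁻¹ *ᵥ v) v] at h2
  rw [le_div_iff₀ hlam]
  nlinarith

lemma inv_dotProduct_inv_le (hA : IsCoerciveMatrix lam A) (hlam : 0 < lam) (v : κ → ℝ) :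
    (A⁻¹ *ᵥ v) ⬝ᵥ (A⁻¹ *ᵥ v) ≤ (v ⬝ᵥ v) / lam ^ 2 := by
  have h1 := hA.mul_dotProduct_inv_le hlam v
  have h2 := hA.dotProduct_inv_le hlam v
  rw [le_div_iff₀ hlam] at h2
  rw [le_div_iff₀ (by positivity)]
  nlinarith

lemma trace_conj_inv_nonneg (hA : IsCoerciveMatrix lam A) (hlam : 0 < lam) {P : Matrix κ κ ℝ}
    (hP : P.IsHermitian) : 0 ≤ (P * A⁻¹ * P).trace := by
  rw [hP.trace_conj_eq_sum]
  exact Finset.sum_nonneg fun j _ => hA.dotProduct_inv_nonneg hlam _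

lemma trace_conj_inv_le (hA : IsCoerciveMatrix lam A) (hlam : 0 < lam) {P : Matrix κ κ ℝ}
    (hP : P.IsHermitian) : (P * A⁻¹ * P).trace ≤ (P * P).trace / lam := by
  have h := hP.trace_conj_eq_sum 1
  rw [mul_one] at h
  rw [hP.trace_conj_eq_sum, h, Finset.sum_div]
  simpa using Finset.sum_le_sum fun j _ => hA.dotProduct_inv_le hlam _

lemma trace_conj_inv_sq_le (hA : IsCoerciveMatrix lam A) (hlam : 0 < lam) {P : Matrix κ κ ℝ}
    (hP : P.IsHermitian) : (P * (A⁻¹ * A⁻¹) * P).trace ≤ (P * P).trace / lam ^ 2 := by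
  have h := hP.trace_conj_eq_sum 1
  rw [mul_one] at h
  rw [hP.trace_conj_eq_sum, h, Finset.sum_div]
  refine Finset.sum_le_sum fun j _ => ?_
  rw [← Matrix.mulVec_mulVec, hA.inv_isHermitian.dotProduct_mulVec_comm, Matrix.one_mulVec]
  exact hA.inv_dotProduct_inv_le hlam _

lemma trace_inv_nonneg (hA : IsCoerciveMatrix lam A) (hlam : 0 < lam) : 0 ≤ A⁻¹.trace := by
  simpa using hA.trace_conj_inv_nonneg hlam Matrix.isHermitian_one

lemma trace_inv_sq_le (hA : IsCoerciveMatrix lam A) (hlam : 0 < lam) :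
    (A⁻¹ * A⁻¹).trace ≤ Fintype.card κ / lam ^ 2 := by
  simpa using hA.trace_conj_inv_sq_le hlam Matrix.isHermitian_one

lemma trace_inv_pow_four_le (hA : IsCoerciveMatrix lam A) (hlam : 0 < lam) :
    (A⁻¹ * A⁻¹ * (A⁻¹ * A⁻¹)).trace ≤ Fintype.card κ / lam ^ 4 := by
  have h1 := hA.trace_conj_inv_sq_le hlam hA.inv_isHermitian
  have h2 := div_le_div_of_nonneg_right (hA.trace_inv_sq_le hlam) (sq_nonneg lam)
  rw [div_div] at h2
  calc _ = (A⁻¹ * (A⁻¹ * A⁻¹) * A⁻¹).trace := by simp only [mul_assoc]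
    _ ≤ _ := h1.trans h2
    _ = _ := by ring

lemma add_smul_one (hA : IsCoerciveMatrix lam A) (h : ℝ) :
    IsCoerciveMatrix (lam + h) (A + h • (1 : Matrix κ κ ℝ)) where
  isHermitian := hA.isHermitian.add (by
    simp [Matrix.IsHermitian])
  coercive v := by
    have := hA.coercive v
    rw [Matrix.add_mulVec, dotProduct_add, Matrix.smul_mulVec, Matrix.one_mulVec, dotProduct_smul,
      smul_eq_mul]
    linarith

lemma inv_sub_inv {B : Matrix κ κ ℝ} (hA : IsCoerciveMatrix lam A) (hB : IsCoerciveMatrix lam B)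
    (hlam : 0 < lam) : B⁻¹ - A⁻¹ = A⁻¹ * (A - B) * B⁻¹ := by
  rw [mul_sub, sub_mul, Matrix.nonsing_inv_mul _ (hA.isUnit_det hlam), mul_assoc,
    Matrix.mul_nonsing_inv _ (hB.isUnit_det hlam), one_mul, mul_one]

/-- The difference quotient of the trace of the resolvent approximates the trace of its square. -/
lemma abs_trace_inv_sq_sub_le (hA : IsCoerciveMatrix lam A) (hlam : 0 < lam) {h : ℝ} (hh : 0 < h) :
    |(A⁻¹ * A⁻¹).trace - (A⁻¹.trace - (A + h • (1 : Matrix κ κ ℝ))⁻¹.trace) / h| ≤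
      h * (Fintype.card κ / lam ^ 3) := by
  have hB : IsCoerciveMatrix lam (A + h • (1 : Matrix κ κ ℝ)) :=
    (hA.add_smul_one h).mono (by linarith)
  set B := A + h • (1 : Matrix κ κ ℝ) with hBdef
  have h1 : A⁻¹ - B⁻¹ = h • (A⁻¹ * B⁻¹) := by
    have hba : A - B = -(h • (1 : Matrix κ κ ℝ)) := by rw [hBdef]; abel
    rw [← neg_sub, hA.inv_sub_inv hB hlam, hba]
    simp
  have h2 : A⁻¹.trace - B⁻¹.trace = h * (A⁻¹ * B⁻¹).trace := by
    rw [← Matrix.trace_sub, h1, Matrix.trace_smul, smul_eq_mul]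
  -- A second use of the resolvent identity makes the error of the difference quotient exactly h
  -- tr(A⁻¹B⁻¹A⁻¹), which is nonnegative.
  have h3 : (A⁻¹ * A⁻¹).trace - (A⁻¹ * B⁻¹).trace = h * (A⁻¹ * B⁻¹ * A⁻¹).trace := by
    rw [← Matrix.trace_sub, ← mul_sub, h1, mul_smul_comm, Matrix.trace_smul, smul_eq_mul,
      Matrix.trace_mul_comm]
  have h4 := hB.trace_conj_inv_nonneg hlam hA.inv_isHermitian
  have h5 := hB.trace_conj_inv_le hlam hA.inv_isHermitian
  have h6 := div_le_div_of_nonneg_right (hA.trace_inv_sq_le hlam) hlam.le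
  have h7 : (Fintype.card κ : ℝ) / lam ^ 2 / lam = Fintype.card κ / lam ^ 3 := by
    field_simp
  rw [h2, mul_div_cancel_left₀ _ hh.ne', h3, abs_of_nonneg (by positivity)]
  exact mul_le_mul_of_nonneg_left ((h5.trans h6).trans h7.le) hh.le

section RankOne

variable {B : Matrix κ κ ℝ} {c : ℝ} {x : κ → ℝ}

lemma rankOne_pos (hB : IsCoerciveMatrix lam B) (hlam : 0 < lam) (hc : 0 ≤ c) :
    0 < 1 + c * (x ⬝ᵥ B⁻¹ *ᵥ x) := by
  have := mul_nonneg hc (hB.dotProduct_inv_nonneg hlam x)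
  linarith

/-- The Sherman–Morrison formula applied to the perturbing vector. -/
lemma inv_add_rankOne_mulVec (hB : IsCoerciveMatrix lam B) (hlam : 0 < lam) (hc : 0 ≤ c) :
    (B + c • Matrix.vecMulVec x x)⁻¹ *ᵥ x = (1 + c * (x ⬝ᵥ B⁻¹ *ᵥ x))⁻¹ • (B⁻¹ *ᵥ x) := by
  have hpos := hB.rankOne_pos (x := x) hlam hc
  refine (hB.add_rankOne hc).inv_mulVec_eq hlam ?_
  rw [Matrix.mulVec_smul, Matrix.add_mulVec, Matrix.smul_mulVec, Matrix.vecMulVec_mulVec,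
    hB.mulVec_inv_mulVec hlam, op_smul_eq_smul, smul_smul]
  have hx : x + (c * (x ⬝ᵥ B⁻¹ *ᵥ x)) • x = (1 + c * (x ⬝ᵥ B⁻¹ *ᵥ x)) • x := by
    rw [add_smul, one_smul]
  rw [hx, smul_smul, inv_mul_cancel₀ hpos.ne', one_smul]

/-- Replaces a form in the full inverse, which itself depends on x, by one in B⁻¹; for leave-one-out
matrices B does not involve x. -/
lemma dotProduct_inv_add_rankOne (hB : IsCoerciveMatrix lam B) (hlam : 0 < lam) (hc : 0 ≤ c) :
    c * (x ⬝ᵥ (B + c • Matrix.vecMulVec x x)⁻¹ *ᵥ x) =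
      c * (x ⬝ᵥ B⁻¹ *ᵥ x) / (1 + c * (x ⬝ᵥ B⁻¹ *ᵥ x)) := by
  rw [hB.inv_add_rankOne_mulVec hlam hc, dotProduct_smul, smul_eq_mul]
  field_simp

/-- A rank-one perturbation changes the trace of the inverse by at most `1 / lam`. -/
lemma abs_trace_inv_sub_rankOne_le (hB : IsCoerciveMatrix lam B) (hlam : 0 < lam) (hc : 0 ≤ c) :
    |B⁻¹.trace - (B + c • Matrix.vecMulVec x x)⁻¹.trace| ≤ 1 / lam := by
  have hpos := hB.rankOne_pos (x := x) hlam hc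
  have h0 := mul_nonneg hc (hB.dotProduct_inv_nonneg hlam x)
  have h1 := hB.mul_dotProduct_inv_le hlam x
  have h2 := dotProduct_self_nonneg_real (B⁻¹ *ᵥ x)
  have htr : B⁻¹.trace - (B + c • Matrix.vecMulVec x x)⁻¹.trace =
      c * ((1 + c * (x ⬝ᵥ B⁻¹ *ᵥ x))⁻¹ * ((B⁻¹ *ᵥ x) ⬝ᵥ (B⁻¹ *ᵥ x))) := by
    rw [← Matrix.trace_sub, (hB.add_rankOne hc).inv_sub_inv hB hlam, add_sub_cancel_left,
      mul_smul_comm, smul_mul_assoc, Matrix.trace_smul, Matrix.mul_vecMulVec,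
      Matrix.vecMulVec_mul, Matrix.trace_vecMulVec, hB.inv_add_rankOne_mulVec hlam hc,
      smul_dotProduct, ← Matrix.mulVec_transpose]
    have : B⁻¹ᵀ = B⁻¹ := by simpa using hB.inv_isHermitian.eq
    rw [this, smul_eq_mul, smul_eq_mul]
  rw [htr, abs_of_nonneg (by positivity), le_div_iff₀ hlam]
  calc c * ((1 + c * (x ⬝ᵥ B⁻¹ *ᵥ x))⁻¹ * ((B⁻¹ *ᵥ x) ⬝ᵥ (B⁻¹ *ᵥ x))) * lam
      = c * (lam * ((B⁻¹ *ᵥ x) ⬝ᵥ (B⁻¹ *ᵥ x))) / (1 + c * (x ⬝ᵥ B⁻¹ *ᵥ x)) := by field_simp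
    -- Coercivity gives a ratio t/(1 + t), so the bound does not depend on the size of x or c.
    _ ≤ c * (x ⬝ᵥ B⁻¹ *ᵥ x) / (1 + c * (x ⬝ᵥ B⁻¹ *ᵥ x)) := by gcongr
    _ ≤ 1 := by rw [div_le_one hpos]; linarith

end RankOne

end IsCoerciveMatrix

end CoerciveMatrix

/-! ### Leave-one-out analysis of the resolvent trace -/

section RegularizedGram

open scoped Matrix

variable {ι κ : Type*} [DecidableEq κ]

/-- The regularized Gram matrix `lam I + c ∑ᵢ xᵢ xᵢᵀ` of the vectors `xᵢ` with `i ∈ s`. -/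
noncomputable def regGram (lam c : ℝ) (s : Finset ι) (x : ι → EuclideanSpace ℝ κ) : Matrix κ κ ℝ :=
  lam • (1 : Matrix κ κ ℝ) + c • ∑ i ∈ s, Matrix.vecMulVec (x i).ofLp (x i).ofLp

lemma regGram_insert [DecidableEq ι] {lam c : ℝ} {s : Finset ι} {i : ι} (hi : i ∉ s)
    (x : ι → EuclideanSpace ℝ κ) :
    regGram lam c (insert i s) x =
      regGram lam c s x + c • Matrix.vecMulVec (x i).ofLp (x i).ofLp := by
  rw [regGram, regGram, Finset.sum_insert hi, smul_add]
  abel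

lemma regGram_add_smul_one (lam c h : ℝ) (s : Finset ι) (x : ι → EuclideanSpace ℝ κ) :
    regGram lam c s x + h • (1 : Matrix κ κ ℝ) = regGram (lam + h) c s x := by
  rw [regGram, regGram, add_smul]
  abel

/-- This is the independence of Bᵢ and xᵢ in the form needed to integrate over xᵢ alone. -/
lemma regGram_erase_update [Fintype ι] [DecidableEq ι] (lam c : ℝ) (x : ι → EuclideanSpace ℝ κ) (i : ι)
    (v : EuclideanSpace ℝ κ) :
    regGram lam c (Finset.univ.erase i) (Function.update x i v) =
      regGram lam c (Finset.univ.erase i) x := by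
  unfold regGram
  congr 2
  refine Finset.sum_congr rfl fun j hj => ?_
  rw [Function.update_of_ne (Finset.ne_of_mem_erase hj)]

lemma regGram_erase_add [Fintype ι] [DecidableEq ι] (lam c : ℝ) (x : ι → EuclideanSpace ℝ κ) (i : ι) :
    regGram lam c (Finset.univ.erase i) x + c • Matrix.vecMulVec (x i).ofLp (x i).ofLp =
      regGram lam c Finset.univ x := by
  rw [← regGram_insert (Finset.notMem_erase i _), Finset.insert_erase (Finset.mem_univ i)]

variable [Fintype κ]

lemma isCoerciveMatrix_regGram (lam : ℝ) {c : ℝ} (hc : 0 ≤ c) (s : Finset ι)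
    (x : ι → EuclideanSpace ℝ κ) : IsCoerciveMatrix lam (regGram lam c s x) := by
  classical
  induction s using Finset.induction_on with
  | empty =>
    refine ⟨?_, fun v => ?_⟩
    · simp [regGram, Matrix.IsHermitian]
    · simp [regGram, Matrix.smul_mulVec]
  | insert i s hi ih =>
    rw [regGram_insert hi]
    exact ih.add_rankOne hc

lemma continuous_regGram_inv {lam c : ℝ} (hlam : 0 < lam) (hc : 0 ≤ c) (s : Finset ι) :
    Continuous fun x : ι → EuclideanSpace ℝ κ => (regGram lam c s x)⁻¹ := by
  simp only [Matrix.inv_def, Ring.inverse_eq_inv']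
  have h : Continuous fun x : ι → EuclideanSpace ℝ κ => regGram lam c s x := by
    unfold regGram
    fun_prop
  exact (h.matrix_det.inv₀ fun x =>
    ((isCoerciveMatrix_regGram lam hc s x).isUnit_det hlam).ne_zero).smul h.matrix_adjugate

variable [Fintype ι] [DecidableEq ι]

/-- The leave-one-out quadratic form `c xᵢᵀ Bᵢ⁻¹ xᵢ`. -/
noncomputable def looQuad (lam c : ℝ) (x : ι → EuclideanSpace ℝ κ) (i : ι) : ℝ :=
  c * ((x i).ofLp ⬝ᵥ (regGram lam c (Finset.univ.erase i) x)⁻¹ *ᵥ (x i).ofLp)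

/-- The leave-one-out normalized trace `c tr Bᵢ⁻¹`. -/
noncomputable def looTrace (lam c : ℝ) (x : ι → EuclideanSpace ℝ κ) (i : ι) : ℝ :=
  c * (regGram lam c (Finset.univ.erase i) x)⁻¹.trace

lemma looQuad_nonneg {lam c : ℝ} (hlam : 0 < lam) (hc : 0 ≤ c) (x : ι → EuclideanSpace ℝ κ)
    (i : ι) : 0 ≤ looQuad lam c x i :=
  mul_nonneg hc ((isCoerciveMatrix_regGram lam hc _ x).dotProduct_inv_nonneg hlam _)

/-- Expand tr(A⁻¹A) over λI and the rank-one terms; Sherman–Morrison turns each c xᵢᵀA⁻¹xᵢ into a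
function of the leave-one-out form. -/
lemma trace_inv_regGram_add_sum_looQuad {lam c : ℝ} (hlam : 0 < lam) (hc : 0 ≤ c)
    (x : ι → EuclideanSpace ℝ κ) :
    lam * (regGram lam c Finset.univ x)⁻¹.trace +
      ∑ i, looQuad lam c x i / (1 + looQuad lam c x i) = Fintype.card κ := by
  have hA := isCoerciveMatrix_regGram lam hc Finset.univ x
  have h1 : ((regGram lam c Finset.univ x)⁻¹ * regGram lam c Finset.univ x).trace =
      Fintype.card κ := by
    rw [Matrix.nonsing_inv_mul _ (hA.isUnit_det hlam), Matrix.trace_one]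
  have h2 : ∀ i, looQuad lam c x i / (1 + looQuad lam c x i) =
      c * ((x i).ofLp ⬝ᵥ (regGram lam c Finset.univ x)⁻¹ *ᵥ (x i).ofLp) := fun i => by
    rw [← regGram_erase_add lam c x i, IsCoerciveMatrix.dotProduct_inv_add_rankOne
      (isCoerciveMatrix_regGram lam hc _ x) hlam hc]
    rfl
  rw [← h1, Finset.sum_congr rfl fun i _ => h2 i]
  generalize (regGram lam c Finset.univ x)⁻¹ = N
  rw [regGram, mul_add, Matrix.trace_add, mul_smul_comm, mul_one, Matrix.trace_smul, mul_smul_comm,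
    Matrix.trace_smul, Matrix.mul_sum, Matrix.trace_sum, smul_eq_mul, smul_eq_mul, Finset.mul_sum]
  congr 1
  refine Finset.sum_congr rfl fun i _ => ?_
  rw [Matrix.mul_vecMulVec, Matrix.trace_vecMulVec, dotProduct_comm]

/-- On g ≥ 0 the map g ↦ λg + g/(1 + γg) has all its slopes at least λ, so the residual of the fixed
point equation controls the distance to its root. -/
lemma mul_abs_sub_mpRoot_le {lam γ g : ℝ} (hlam : 0 < lam) (hγ : 0 < γ) (hg : 0 ≤ g) :
    lam * |g - mpRoot lam γ| ≤ |lam * g + g / (1 + γ * g) - 1| := by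
  have hr := mpRoot_nonneg hlam hγ
  have hfix := mpRoot_fixed_point hlam hγ
  set r := mpRoot lam γ
  have h1 : 0 < 1 + γ * g := by positivity
  have h2 : 0 < 1 + γ * r := by positivity
  have h3 : lam * g + g / (1 + γ * g) - (lam * r + r / (1 + γ * r)) =
      (lam + 1 / ((1 + γ * g) * (1 + γ * r))) * (g - r) := by
    field_simp
    ring
  rw [hfix] at h3
  have h4 : 0 ≤ 1 / ((1 + γ * g) * (1 + γ * r)) := by positivity
  rw [h3, abs_mul, abs_of_nonneg (by positivity : 0 ≤ lam + 1 / ((1 + γ * g) * (1 + γ * r)))]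
  exact mul_le_mul_of_nonneg_right (by linarith) (abs_nonneg _)

lemma abs_div_one_add_sub_le {s t : ℝ} (hs : 0 ≤ s) (ht : 0 ≤ t) :
    |s / (1 + s) - t / (1 + t)| ≤ |s - t| := by
  have h : s / (1 + s) - t / (1 + t) = (s - t) / ((1 + s) * (1 + t)) := by
    field_simp
    ring
  rw [h, abs_div, abs_of_pos (by positivity : 0 < (1 + s) * (1 + t))]
  exact div_le_self (abs_nonneg _) (by nlinarith)

/-- The normalized trace of the resolvent of a sample covariance matrix is close to the
Marchenko–Pastur Stieltjes transform as soon as the leave-one-out quadratic forms are close to the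
leave-one-out traces. -/
lemma mul_abs_resolvent_sub_mpRoot_le [Nonempty ι] [Nonempty κ] {lam : ℝ} (hlam : 0 < lam)
    (x : ι → EuclideanSpace ℝ κ) :
    lam * |(regGram lam (1 / Fintype.card ι) Finset.univ x)⁻¹.trace / Fintype.card κ -
        mpRoot lam (Fintype.card κ / Fintype.card ι)| ≤
      (1 / lam + ∑ i, |looQuad lam (1 / Fintype.card ι) x i -
        looTrace lam (1 / Fintype.card ι) x i|) / Fintype.card κ := by
  set d : ℝ := (Fintype.card κ : ℝ) with hd_def
  set n : ℝ := (Fintype.card ι : ℝ) with hn_def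
  have hd : 0 < d := by simp [hd_def, Fintype.card_pos]
  have hn : 0 < n := by simp [hn_def, Fintype.card_pos]
  have hc : (0 : ℝ) ≤ 1 / n := by positivity
  have hA := isCoerciveMatrix_regGram lam hc Finset.univ x
  have hsum := trace_inv_regGram_add_sum_looQuad hlam hc x
  have hq := looQuad_nonneg hlam hc x
  have htr := hA.trace_inv_nonneg hlam
  -- Passing from Bᵢ to A costs 1/(nλ) for each i, hence only 1/λ after summing over the n samples.
  have hloo : ∀ i, |(1 / n) * (regGram lam (1 / n) Finset.univ x)⁻¹.trace -
      looQuad lam (1 / n) x i| ≤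
      |looQuad lam (1 / n) x i - looTrace lam (1 / n) x i| + 1 / n * (1 / lam) := fun i => by
    have h := IsCoerciveMatrix.abs_trace_inv_sub_rankOne_le (x := (x i).ofLp)
      (isCoerciveMatrix_regGram lam hc (Finset.univ.erase i) x) hlam hc
    rw [regGram_erase_add] at h
    have h' := mul_le_mul_of_nonneg_left h hc
    rw [← abs_of_nonneg hc, ← abs_mul, abs_of_nonneg hc, mul_sub] at h'
    have h'' := abs_sub_le ((1 / n) * (regGram lam (1 / n) Finset.univ x)⁻¹.trace)
      (looTrace lam (1 / n) x i) (looQuad lam (1 / n) x i)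
    rw [abs_sub_comm _ (looTrace lam (1 / n) x i),
      abs_sub_comm (looTrace lam (1 / n) x i) (looQuad lam (1 / n) x i)] at h''
    unfold looTrace at h'' ⊢
    linarith
  set T := (regGram lam (1 / n) Finset.univ x)⁻¹.trace with hT
  have ht : 0 ≤ 1 / n * T := mul_nonneg hc htr
  refine (mul_abs_sub_mpRoot_le hlam (div_pos hd hn) (div_nonneg htr hd.le)).trans ?_
  -- The exact trace identity expresses the residual as the error made by replacing every qᵢ by the
  -- common value T/n.
  have hid : lam * (T / d) + T / d / (1 + d / n * (T / d)) - 1 =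
      (∑ i, ((1 / n * T) / (1 + 1 / n * T) -
        looQuad lam (1 / n) x i / (1 + looQuad lam (1 / n) x i))) / d := by
    have e1 : ∑ i, looQuad lam (1 / n) x i / (1 + looQuad lam (1 / n) x i) = d - lam * T := by
      linarith
    rw [Finset.sum_sub_distrib, Finset.sum_const, Finset.card_univ, nsmul_eq_mul, ← hn_def, e1]
    have e2 : d / n * (T / d) = 1 / n * T := by field_simp
    rw [e2]
    have : 0 < 1 + 1 / n * T := by linarith
    field_simp
    ring
  rw [hid, abs_div, abs_of_pos hd]
  refine div_le_div_of_nonneg_right ?_ hd.le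
  calc _ ≤ ∑ i, |(1 / n * T) / (1 + 1 / n * T) -
        looQuad lam (1 / n) x i / (1 + looQuad lam (1 / n) x i)| := Finset.abs_sum_le_sum_abs _ _
    _ ≤ ∑ i, (|looQuad lam (1 / n) x i - looTrace lam (1 / n) x i| + 1 / n * (1 / lam)) :=
        Finset.sum_le_sum fun i _ => (abs_div_one_add_sub_le ht (hq i)).trans (hloo i)
    _ = _ := by
        rw [Finset.sum_add_distrib, Finset.sum_const, Finset.card_univ, nsmul_eq_mul, ← hn_def]
        field_simp
        ring

lemma continuous_looQuad {lam c : ℝ} (hlam : 0 < lam) (hc : 0 ≤ c) (i : ι) :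
    Continuous fun x : ι → EuclideanSpace ℝ κ => looQuad lam c x i := by
  have := continuous_regGram_inv (κ := κ) hlam hc (Finset.univ.erase i)
  unfold looQuad
  fun_prop

lemma continuous_looTrace {lam c : ℝ} (hlam : 0 < lam) (hc : 0 ≤ c) (i : ι) :
    Continuous fun x : ι → EuclideanSpace ℝ κ => looTrace lam c x i := by
  have := continuous_regGram_inv (κ := κ) hlam hc (Finset.univ.erase i)
  unfold looTrace
  fun_prop

/-- With all samples but the i-th frozen, Bᵢ is a fixed matrix and the quadratic form variance
applies; the bound is uniform in the frozen samples. -/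
lemma lintegral_looQuad_sub_looTrace_le {lam c : ℝ} (hlam : 0 < lam) (hc : 0 ≤ c) (i : ι) :
    ∫⁻ x, ENNReal.ofReal ((looQuad lam c x i - looTrace lam c x i) ^ 2)
      ∂(Measure.pi fun _ : ι => stdGaussian (EuclideanSpace ℝ κ)) ≤
      ENNReal.ofReal (gaussianSqVar * (c ^ 2 * (Fintype.card κ / lam ^ 2))) := by
  have h1 := continuous_looQuad (κ := κ) hlam hc i
  have h2 := continuous_looTrace (κ := κ) hlam hc i
  have hle := lintegral_le_of_lmarginal_le
    (μ := fun _ : ι => stdGaussian (EuclideanSpace ℝ κ)) {i}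
    (f := fun x => ENNReal.ofReal ((looQuad lam c x i - looTrace lam c x i) ^ 2))
    (g := fun _ => ENNReal.ofReal (gaussianSqVar * (c ^ 2 * (Fintype.card κ / lam ^ 2))))
    ((h1.sub h2).pow 2).measurable.ennreal_ofReal measurable_const ?_
  · simpa using hle
  rw [lmarginal_singleton, lmarginal_singleton]
  intro x
  have hB := isCoerciveMatrix_regGram lam hc (Finset.univ.erase i) x
  set B := regGram lam c (Finset.univ.erase i) x with hBdef
  have hM : (c • B⁻¹).IsHermitian := by
    have := hB.inv_isHermitian
    unfold Matrix.IsHermitian at this ⊢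
    rw [Matrix.conjTranspose_smul, this]
    simp
  have hq := lintegral_quadForm_stdGaussian hM
  simp only [looQuad, looTrace, regGram_erase_update, Function.update_self, ← hBdef,
    lintegral_const, measure_univ, mul_one]
  simp only [Matrix.smul_mulVec, dotProduct_smul, Matrix.trace_smul, smul_eq_mul,
    smul_mul_smul_comm, ← pow_two c] at hq
  rw [hq]
  refine ENNReal.ofReal_le_ofReal (mul_le_mul_of_nonneg_left
    (mul_le_mul_of_nonneg_left (hB.trace_inv_sq_le hlam) (sq_nonneg c)) gaussianSqVar_nonneg)

/-- Mean square convergence rate of the normalized trace of the resolvent. -/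
lemma lintegral_resolvent_sub_mpRoot_le [Nonempty ι] [Nonempty κ] {lam : ℝ} (hlam : 0 < lam) :
    ∫⁻ x, ENNReal.ofReal (((regGram lam (1 / Fintype.card ι) Finset.univ x)⁻¹.trace /
        Fintype.card κ - mpRoot lam (Fintype.card κ / Fintype.card ι)) ^ 2)
      ∂(Measure.pi fun _ : ι => stdGaussian (EuclideanSpace ℝ κ)) ≤
      ENNReal.ofReal (2 / (Fintype.card κ ^ 2 * lam ^ 4) +
        2 * gaussianSqVar / (Fintype.card κ * lam ^ 4)) := by
  have hdet := mul_abs_resolvent_sub_mpRoot_le (ι := ι) (κ := κ) hlam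
  have hE := lintegral_looQuad_sub_looTrace_le (ι := ι) (κ := κ) (c := 1 / Fintype.card ι) hlam
    (by positivity)
  set d : ℝ := (Fintype.card κ : ℝ) with hd_def
  set n : ℝ := (Fintype.card ι : ℝ) with hn_def
  have hd : 0 < d := by simp [hd_def, Fintype.card_pos]
  have hn : 0 < n := by simp [hn_def, Fintype.card_pos]
  have hc : (0 : ℝ) ≤ 1 / n := by positivity
  have hpt : ∀ x : ι → EuclideanSpace ℝ κ,
      ((regGram lam (1 / n) Finset.univ x)⁻¹.trace / d - mpRoot lam (d / n)) ^ 2 ≤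
      2 / (d ^ 2 * lam ^ 4) + (2 * n / (d ^ 2 * lam ^ 2)) *
        ∑ i, (looQuad lam (1 / n) x i - looTrace lam (1 / n) x i) ^ 2 := fun x => by
    have h := hdet x
    set e := (regGram lam (1 / n) Finset.univ x)⁻¹.trace / d - mpRoot lam (d / n)
    set S := ∑ i, |looQuad lam (1 / n) x i - looTrace lam (1 / n) x i| with hS
    -- Cauchy–Schwarz loses a factor n, harmless since each term has mean square O(d/n²): n · n ·
    -- (d/n²)/d² = 1/d.
    have hS2 : S ^ 2 ≤ n * ∑ i, (looQuad lam (1 / n) x i - looTrace lam (1 / n) x i) ^ 2 := by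
      have := sq_sum_le_card_mul_sum_sq (s := Finset.univ)
        (f := fun i => |looQuad lam (1 / n) x i - looTrace lam (1 / n) x i|)
      simpa only [sq_abs, Finset.card_univ] using this
    have h2 : (lam * |e|) ^ 2 ≤ ((1 / lam + S) / d) ^ 2 :=
      pow_le_pow_left₀ (by positivity) h 2
    rw [mul_pow, sq_abs, div_pow] at h2
    have h3 : (1 / lam + S) ^ 2 ≤ 2 * (1 / lam) ^ 2 + 2 * S ^ 2 := by
      nlinarith [sq_nonneg (1 / lam - S)]
    have h4 : lam ^ 2 * e ^ 2 ≤ (2 * (1 / lam) ^ 2 + 2 *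
        (n * ∑ i, (looQuad lam (1 / n) x i - looTrace lam (1 / n) x i) ^ 2)) / d ^ 2 :=
      h2.trans (div_le_div_of_nonneg_right (by linarith) (sq_nonneg d))
    have h5 := div_le_div_of_nonneg_right h4 (sq_nonneg lam)
    rw [mul_div_cancel_left₀ _ (by positivity : lam ^ 2 ≠ 0)] at h5
    refine h5.trans_eq ?_
    field_simp
  calc _ ≤ ∫⁻ x, (ENNReal.ofReal (2 / (d ^ 2 * lam ^ 4)) +
          ENNReal.ofReal (2 * n / (d ^ 2 * lam ^ 2)) * ∑ i, ENNReal.ofReal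
            ((looQuad lam (1 / n) x i - looTrace lam (1 / n) x i) ^ 2))
          ∂(Measure.pi fun _ : ι => stdGaussian (EuclideanSpace ℝ κ)) := by
        refine lintegral_mono fun x => ?_
        refine (ENNReal.ofReal_le_ofReal (hpt x)).trans_eq ?_
        rw [ENNReal.ofReal_add (by positivity) (by positivity),
          ENNReal.ofReal_mul (by positivity), ENNReal.ofReal_sum_of_nonneg fun i _ => sq_nonneg _]
    _ = ENNReal.ofReal (2 / (d ^ 2 * lam ^ 4)) +
          ENNReal.ofReal (2 * n / (d ^ 2 * lam ^ 2)) * ∑ i, ∫⁻ x, ENNReal.ofReal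
            ((looQuad lam (1 / n) x i - looTrace lam (1 / n) x i) ^ 2)
            ∂(Measure.pi fun _ : ι => stdGaussian (EuclideanSpace ℝ κ)) := by
        have hm : ∀ i, Measurable fun x : ι → EuclideanSpace ℝ κ => ENNReal.ofReal
            ((looQuad lam (1 / n) x i - looTrace lam (1 / n) x i) ^ 2) := fun i =>
          (((continuous_looQuad hlam hc i).sub (continuous_looTrace hlam hc i)).pow
            2).measurable.ennreal_ofReal
        rw [lintegral_add_left measurable_const, lintegral_const_mul _
          (Finset.measurable_sum _ fun i _ => hm i), lintegral_finsetSum _ fun i _ => hm i]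
        simp
    _ ≤ ENNReal.ofReal (2 / (d ^ 2 * lam ^ 4)) +
          ENNReal.ofReal (2 * n / (d ^ 2 * lam ^ 2)) * ∑ _i : ι,
            ENNReal.ofReal (gaussianSqVar * ((1 / n) ^ 2 * (d / lam ^ 2))) := by
        gcongr with i
        exact hE i
    _ = _ := by
        have := gaussianSqVar_nonneg
        rw [← ENNReal.ofReal_sum_of_nonneg fun i _ => by positivity,
          ← ENNReal.ofReal_mul (by positivity), ← ENNReal.ofReal_add (by positivity)
          (by positivity), Finset.sum_const, Finset.card_univ, nsmul_eq_mul, ← hn_def]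
        congr 1
        field_simp

end RegularizedGram

/-! ### Normal equations and test error -/

section RidgeRisk

open scoped Matrix

lemma linear_coeff_eq_zero_of_nonneg {p q : ℝ} (h : ∀ t : ℝ, 0 ≤ t * p + t ^ 2 * q) : p = 0 := by
  have hmin : IsLocalMin (fun t : ℝ => t * p + t ^ 2 * q) 0 :=
    Filter.Eventually.of_forall fun t => by simpa using h t
  have hd : HasDerivAt (fun t : ℝ => t * p + t ^ 2 * q) p 0 := by
    have := ((hasDerivAt_id (0 : ℝ)).mul_const p).add ((hasDerivAt_pow 2 (0 : ℝ)).mul_const q)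
    refine this.congr_deriv ?_
    simp
  exact hmin.hasDerivAt_eq_zero hd

lemma euclidean_inner_eq_dotProduct {κ : Type*} [Fintype κ] (u v : EuclideanSpace ℝ κ) :
    inner ℝ u v = u.ofLp ⬝ᵥ v.ofLp := by
  rw [EuclideanSpace.inner_eq_star_dotProduct, dotProduct_comm]; simp

/-- The bias-plus-noise vector `lam β - c ∑ᵢ εᵢ xᵢ`, which is `A (β - βhat)` for the ridge
estimator `βhat`. -/
noncomputable def ridgeSource {κ ι : Type*} [Fintype ι] (lam c : ℝ) (β : EuclideanSpace ℝ κ)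
    (x : ι → EuclideanSpace ℝ κ) (ε : ι → ℝ) : κ → ℝ :=
  lam • β.ofLp - c • ∑ i, ε i • (x i).ofLp

/-- The excess test error of the ridge estimator. -/
noncomputable def ridgeRisk {κ ι : Type*} [Fintype κ] [DecidableEq κ] [Fintype ι] (lam c : ℝ)
    (β : EuclideanSpace ℝ κ) (x : ι → EuclideanSpace ℝ κ) (ε : ι → ℝ) : ℝ :=
  ((regGram lam c Finset.univ x)⁻¹ *ᵥ ridgeSource lam c β x ε) ⬝ᵥ
    ((regGram lam c Finset.univ x)⁻¹ *ᵥ ridgeSource lam c β x ε)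

lemma dotProduct_regGram_mulVec {κ ι : Type*} [Fintype κ] [DecidableEq κ] [Fintype ι] (lam c : ℝ)
    (x : ι → EuclideanSpace ℝ κ) (v u : κ → ℝ) :
    v ⬝ᵥ regGram lam c Finset.univ x *ᵥ u =
      lam * (v ⬝ᵥ u) + c * ∑ i, (u ⬝ᵥ (x i).ofLp) * (v ⬝ᵥ (x i).ofLp) := by
  rw [regGram, Matrix.add_mulVec, dotProduct_add, Matrix.smul_mulVec, Matrix.one_mulVec,
    dotProduct_smul, Matrix.smul_mulVec, dotProduct_smul, Matrix.sum_mulVec, dotProduct_sum,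
    smul_eq_mul, smul_eq_mul]
  congr 2
  refine Finset.sum_congr rfl fun i _ => ?_
  rw [Matrix.vecMulVec_mulVec, op_smul_eq_smul, dotProduct_smul, smul_eq_mul, dotProduct_comm u]

lemma ridgeObjective_add_smul {d n : ℕ} (lam : ℝ) (x : Fin n → EuclideanSpace ℝ (Fin d))
    (y : Fin n → ℝ) (b v : EuclideanSpace ℝ (Fin d)) (t : ℝ) :
    ridgeObjective lam x y (b + t • v) = ridgeObjective lam x y b +
      (t * (2 * (lam * inner ℝ b v - 1 / (n : ℝ) * ∑ i, (y i - inner ℝ b (x i)) * inner ℝ v (x i)))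
        + t ^ 2 * (1 / (n : ℝ) * ∑ i, inner ℝ v (x i) ^ 2 + lam * ‖v‖ ^ 2)) := by
  have h1 : ∑ i, (y i - inner ℝ (b + t • v) (x i)) ^ 2 = ∑ i, (y i - inner ℝ b (x i)) ^ 2 -
      2 * t * ∑ i, (y i - inner ℝ b (x i)) * inner ℝ v (x i) +
      t ^ 2 * ∑ i, inner ℝ v (x i) ^ 2 := by
    rw [Finset.mul_sum, Finset.mul_sum, ← Finset.sum_sub_distrib, ← Finset.sum_add_distrib]
    refine Finset.sum_congr rfl fun i _ => ?_
    rw [inner_add_left, real_inner_smul_left]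
    ring
  have h2 : ‖b + t • v‖ ^ 2 = ‖b‖ ^ 2 + 2 * t * inner ℝ b v + t ^ 2 * ‖v‖ ^ 2 := by
    rw [norm_add_sq_real, real_inner_smul_right, norm_smul, mul_pow, Real.norm_eq_abs, sq_abs]
    ring
  rw [ridgeObjective, ridgeObjective, h1, h2]
  ring

/-- The normal equations of ridge regression. -/
lemma regGram_mulVec_sub_of_isMinOn {d n : ℕ} {lam : ℝ} {x : Fin n → EuclideanSpace ℝ (Fin d)}
    {ε : Fin n → ℝ} {β b : EuclideanSpace ℝ (Fin d)}
    (h : IsMinOn (ridgeObjective lam x (fun i => linearLabel β (x i) (ε i))) Set.univ b) :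
    regGram lam (1 / n) Finset.univ x *ᵥ (β - b).ofLp = ridgeSource lam (1 / n) β x ε := by
  refine dotProduct_eq _ _ fun v => ?_
  have hlin := linear_coeff_eq_zero_of_nonneg fun t => by
    have := isMinOn_iff.1 h (b + t • WithLp.toLp 2 v) (Set.mem_univ _)
    rw [ridgeObjective_add_smul] at this
    exact nonneg_of_le_add_right this
  have hr : ∀ i, linearLabel β (x i) (ε i) - inner ℝ b (x i) =
      (β - b).ofLp ⬝ᵥ (x i).ofLp + ε i := fun i => by
    rw [← euclidean_inner_eq_dotProduct, inner_sub_left, linearLabel]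
    ring
  simp_rw [hr, euclidean_inner_eq_dotProduct, add_mul, Finset.sum_add_distrib] at hlin
  rw [dotProduct_comm, dotProduct_regGram_mulVec, ridgeSource, sub_dotProduct, smul_dotProduct,
    smul_dotProduct, sum_dotProduct]
  simp only [dotProduct_smul, smul_eq_mul, dotProduct_comm _ v, WithLp.ofLp_sub,
    dotProduct_sub] at hlin ⊢
  linarith

lemma norm_sub_sq_eq_ridgeRisk {d n : ℕ} {lam : ℝ} (hlam : 0 < lam)
    {x : Fin n → EuclideanSpace ℝ (Fin d)}
    {ε : Fin n → ℝ} {β b : EuclideanSpace ℝ (Fin d)}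
    (h : IsMinOn (ridgeObjective lam x (fun i => linearLabel β (x i) (ε i))) Set.univ b) :
    ‖β - b‖ ^ 2 = ridgeRisk lam (1 / n) β x ε := by
  have hA := isCoerciveMatrix_regGram lam (c := 1 / n) (by positivity) Finset.univ x
  rw [ridgeRisk, hA.inv_mulVec_eq hlam (regGram_mulVec_sub_of_isMinOn h),
    ← euclidean_inner_eq_dotProduct, real_inner_self_eq_norm_sq]

lemma integral_inner_sq_stdGaussian {d : ℕ} (u : EuclideanSpace ℝ (Fin d)) :
    ∫ z, (inner ℝ u z : ℝ) ^ 2 ∂(stdGaussian (EuclideanSpace ℝ (Fin d))) = ‖u‖ ^ 2 := by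
  have h := variance_dual_stdGaussian (E := EuclideanSpace ℝ (Fin d)) (innerSL ℝ u)
  rw [variance_of_integral_eq_zero (by fun_prop) (integral_strongDual_stdGaussian _)] at h
  simpa using h

/-- The prediction error is ⟨β − b, x⟩ + ε; the cross term integrates to zero by independence and
centering. -/
lemma testError_eq {d : ℕ} (σ : ℝ≥0) (β b : EuclideanSpace ℝ (Fin d)) :
    testError σ β b = σ ^ 2 + ‖β - b‖ ^ 2 := by
  have hμ : MemLp (fun z : EuclideanSpace ℝ (Fin d) => (inner ℝ (β - b) z : ℝ)) 2
      (stdGaussian (EuclideanSpace ℝ (Fin d))) :=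
    (IsGaussian.memLp_two_id (μ := stdGaussian (EuclideanSpace ℝ (Fin d)))).continuousLinearMap_comp
      (innerSL ℝ (β - b))
  have hν : MemLp (fun e : ℝ => e) 2 (gaussianReal 0 (σ ^ 2)) := IsGaussian.memLp_two_id
  have hmean : ∫ z, (inner ℝ (β - b) z : ℝ) ∂(stdGaussian (EuclideanSpace ℝ (Fin d))) = 0 :=
    integral_strongDual_stdGaussian (innerSL ℝ (β - b))
  have hexp : ∀ z : EuclideanSpace ℝ (Fin d) × ℝ,
      (linearLabel β z.1 z.2 - inner ℝ b z.1) ^ 2 =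
      (inner ℝ (β - b) z.1 : ℝ) ^ 2 + 2 * (inner ℝ (β - b) z.1 * z.2) + z.2 ^ 2 := fun z => by
    rw [linearLabel, inner_sub_left]; ring
  unfold testError
  simp_rw [hexp]
  have i1 : Integrable (fun z : EuclideanSpace ℝ (Fin d) × ℝ => (inner ℝ (β - b) z.1 : ℝ) ^ 2)
      ((stdGaussian (EuclideanSpace ℝ (Fin d))).prod (gaussianReal 0 (σ ^ 2))) :=
    hμ.integrable_sq.comp_fst _
  have i2 : Integrable (fun z : EuclideanSpace ℝ (Fin d) × ℝ => 2 * (inner ℝ (β - b) z.1 * z.2))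
      ((stdGaussian (EuclideanSpace ℝ (Fin d))).prod (gaussianReal 0 (σ ^ 2))) :=
    ((hμ.integrable (by norm_num)).mul_prod (hν.integrable (by norm_num))).const_mul 2
  have i3 : Integrable (fun z : EuclideanSpace ℝ (Fin d) × ℝ => z.2 ^ 2)
      ((stdGaussian (EuclideanSpace ℝ (Fin d))).prod (gaussianReal 0 (σ ^ 2))) :=
    hν.integrable_sq.comp_snd _
  rw [integral_add (by exact i1.add i2) i3, integral_add i1 i2, integral_const_mul, integral_prod_mul
    (fun z : EuclideanSpace ℝ (Fin d) => (inner ℝ (β - b) z : ℝ)) (fun e : ℝ => e), hmean,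
    integral_fun_fst (fun z : EuclideanSpace ℝ (Fin d) => (inner ℝ (β - b) z : ℝ) ^ 2),
    integral_fun_snd (fun e : ℝ => e ^ 2), integral_inner_sq_stdGaussian, integral_sq_gaussianReal]
  simp [add_comm]

end RidgeRisk

/-! ### Concentration of the risk given the covariates -/

section ConditionalRisk

open scoped Matrix

lemma measurePreserving_smul_stdGaussian {ι : Type*} [Fintype ι] [DecidableEq ι] {v : ℝ}
    (hv : 0 ≤ v) :
    MeasurePreserving (fun z : EuclideanSpace ℝ ι => √v • z) (stdGaussian (EuclideanSpace ℝ ι))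
      (multivariateGaussian 0 (v • (1 : Matrix ι ι ℝ))) where
  measurable := by fun_prop
  map_eq := by
    have hS : (v • (1 : Matrix ι ι ℝ)).PosSemidef := Matrix.PosSemidef.one.smul hv
    apply Measure.ext_of_charFun
    ext t
    rw [charFun_map_smul, charFun_stdGaussian, charFun_multivariateGaussian hS]
    congr 1
    rw [Matrix.smul_mulVec, Matrix.one_mulVec, dotProduct_smul, ← euclidean_inner_eq_dotProduct,
      real_inner_self_eq_norm_sq, norm_smul, Real.norm_of_nonneg (Real.sqrt_nonneg v),
      ← Complex.ofReal_pow, mul_pow, Real.sq_sqrt hv]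
    simp
    ring

lemma measurePreserving_mul_gaussianReal (σ : ℝ≥0) :
    MeasurePreserving (fun z : ℝ => (σ : ℝ) * z) (gaussianReal 0 1) (gaussianReal 0 (σ ^ 2)) where
  measurable := by fun_prop
  map_eq := by
    rw [gaussianReal_map_const_mul]
    congr 1
    · simp
    · rw [mul_one]
      ext
      simp

/-- The target vector and the noise as linear images of independent standard Gaussians. -/
lemma measurePreserving_signal_noise (d n : ℕ) (σ : ℝ≥0) :
    MeasurePreserving (fun z : Fin d ⊕ Fin n → ℝ =>
        (√((d : ℝ)⁻¹) • WithLp.toLp 2 (fun j => z (Sum.inl j)), fun i => (σ : ℝ) * z (Sum.inr i)))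
      (Measure.pi fun _ => gaussianReal 0 1)
      ((multivariateGaussian 0 ((d : ℝ)⁻¹ • (1 : Matrix (Fin d) (Fin d) ℝ))).prod
        (Measure.pi fun _ : Fin n => gaussianReal 0 (σ ^ 2))) := by
  have h1 := measurePreserving_sumPiEquivProdPi (fun _ : Fin d ⊕ Fin n => gaussianReal 0 1)
  have h2 : MeasurePreserving (WithLp.toLp 2) (Measure.pi fun _ : Fin d => gaussianReal 0 1)
      (stdGaussian (EuclideanSpace ℝ (Fin d))) := ⟨by fun_prop, map_pi_eq_stdGaussian⟩
  have h3 := (measurePreserving_smul_stdGaussian (ι := Fin d) (v := (d : ℝ)⁻¹)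
    (by positivity)).comp h2
  have h4 := measurePreserving_pi (fun _ : Fin n => gaussianReal 0 1)
    (fun _ : Fin n => gaussianReal 0 (σ ^ 2)) fun _ => measurePreserving_mul_gaussianReal σ
  exact (h3.prod h4).comp h1

/-- The conditional covariance `c₁ A⁻² + c₂ A⁻¹` of the error of the ridge estimator. -/
noncomputable def ridgeCov {κ : Type*} [Fintype κ] [DecidableEq κ] (c₁ c₂ : ℝ)
    (A : Matrix κ κ ℝ) : Matrix κ κ ℝ :=
  c₁ • (A⁻¹ * A⁻¹) + c₂ • A⁻¹

lemma Matrix.IsHermitian.trace_mul_self_nonneg {κ : Type*} [Fintype κ] [DecidableEq κ]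
    {P : Matrix κ κ ℝ} (hP : P.IsHermitian) : 0 ≤ (P * P).trace := by
  rw [hP.trace_mul_self_eq_sum]
  positivity

/-- tr (P + Q)² ≤ 2 tr P² + 2 tr Q², the defect being tr (P − Q)² ≥ 0. This needs no sign of c₁,
which is negative in the application when noise dominates. -/
lemma IsCoerciveMatrix.trace_ridgeCov_sq_le {κ : Type*} [Fintype κ] [DecidableEq κ] {lam : ℝ}
    {A : Matrix κ κ ℝ} (hA : IsCoerciveMatrix lam A) (hlam : 0 < lam) (c₁ c₂ : ℝ) :
    (ridgeCov c₁ c₂ A * ridgeCov c₁ c₂ A).trace ≤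
      2 * c₁ ^ 2 * (Fintype.card κ / lam ^ 4) + 2 * c₂ ^ 2 * (Fintype.card κ / lam ^ 2) := by
  have h1 := mul_le_mul_of_nonneg_left (hA.trace_inv_pow_four_le hlam)
    (by positivity : 0 ≤ 2 * c₁ ^ 2)
  have h2 := mul_le_mul_of_nonneg_left (hA.trace_inv_sq_le hlam)
    (by positivity : 0 ≤ 2 * c₂ ^ 2)
  have hi : (A⁻¹)ᴴ = A⁻¹ := hA.inv_isHermitian
  have hM : (c₁ • (A⁻¹ * A⁻¹) - c₂ • A⁻¹).IsHermitian := by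
    rw [Matrix.IsHermitian, Matrix.conjTranspose_sub, Matrix.conjTranspose_smul,
      Matrix.conjTranspose_smul, Matrix.conjTranspose_mul, hi]
    simp
  have h3 := hM.trace_mul_self_nonneg
  simp only [ridgeCov, sub_mul, mul_sub, add_mul, mul_add, smul_mul_smul_comm, Matrix.trace_sub,
    Matrix.trace_add, Matrix.trace_smul, smul_eq_mul] at h3 ⊢
  linarith

variable {d n : ℕ}

/-- The linear map sending the standardized signal and noise to the error of the ridge estimator. -/
noncomputable def ridgeErrorMatrix (lam σ : ℝ) (x : Fin n → EuclideanSpace ℝ (Fin d)) :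
    Matrix (Fin d) (Fin d ⊕ Fin n) ℝ :=
  (regGram lam (1 / n) Finset.univ x)⁻¹ *
    Matrix.fromCols ((lam * √((d : ℝ)⁻¹)) • (1 : Matrix (Fin d) (Fin d) ℝ))
      (-((1 / n * σ) • Matrix.of fun k i => (x i).ofLp k))

lemma ridgeErrorMatrix_mulVec (lam σ : ℝ) (x : Fin n → EuclideanSpace ℝ (Fin d))
    (z : Fin d ⊕ Fin n → ℝ) :
    ridgeErrorMatrix lam σ x *ᵥ z = (regGram lam (1 / n) Finset.univ x)⁻¹ *ᵥ
      ridgeSource lam (1 / n) (√((d : ℝ)⁻¹) • WithLp.toLp 2 (fun j => z (Sum.inl j))) x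
        (fun i => σ * z (Sum.inr i)) := by
  rw [ridgeErrorMatrix, ← Matrix.mulVec_mulVec, Matrix.fromCols_mulVec, ridgeSource]
  congr 1
  rw [Matrix.neg_mulVec, ← sub_eq_add_neg, Matrix.smul_mulVec, Matrix.smul_mulVec,
    Matrix.one_mulVec]
  congr 1
  · rw [WithLp.ofLp_smul, smul_smul]
    rfl
  · rw [mul_smul]
    congr 1
    ext k
    simp [Matrix.mulVec, dotProduct, Finset.mul_sum]
    exact Finset.sum_congr rfl fun i _ => by ring

/-- Since n⁻¹ ∑ xᵢxᵢᵀ = A − λI, the product is A⁻¹((λ²/d)I + (σ²/n)(A − λI))A⁻¹. -/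
lemma ridgeErrorMatrix_mul_transpose {lam : ℝ} (hlam : 0 < lam) (σ : ℝ)
    (x : Fin n → EuclideanSpace ℝ (Fin d)) :
    ridgeErrorMatrix lam σ x * (ridgeErrorMatrix lam σ x)ᵀ =
      ridgeCov (lam ^ 2 / d - σ ^ 2 * lam / n) (σ ^ 2 / n) (regGram lam (1 / n) Finset.univ x) := by
  have hA := isCoerciveMatrix_regGram lam (c := 1 / n) (by positivity) Finset.univ x
  have hi : ((regGram lam (1 / n) Finset.univ x)⁻¹)ᵀ = (regGram lam (1 / n) Finset.univ x)⁻¹ := by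
    simpa using hA.inv_isHermitian.eq
  have hX : (Matrix.of fun k i => (x i).ofLp k) * (Matrix.of fun k i => (x i).ofLp k)ᵀ =
      ∑ i, Matrix.vecMulVec (x i).ofLp (x i).ofLp := by
    ext k l
    simp [Matrix.mul_apply, Matrix.sum_apply, Matrix.vecMulVec_apply]
  have hG : (1 / (n : ℝ)) • ∑ i, Matrix.vecMulVec (x i).ofLp (x i).ofLp =
      regGram lam (1 / n) Finset.univ x - lam • (1 : Matrix (Fin d) (Fin d) ℝ) := by
    rw [regGram]; abel
  have hsq : (lam * √((d : ℝ)⁻¹)) * (lam * √((d : ℝ)⁻¹)) = lam ^ 2 / d := by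
    rw [mul_mul_mul_comm, Real.mul_self_sqrt (by positivity)]
    ring
  rw [ridgeErrorMatrix, Matrix.transpose_mul, Matrix.transpose_fromCols, hi, Matrix.mul_assoc,
    ← Matrix.mul_assoc (Matrix.fromCols _ _), Matrix.fromCols_mul_fromRows, Matrix.transpose_neg,
    Matrix.transpose_smul, Matrix.transpose_smul, Matrix.transpose_one, Matrix.neg_mul,
    Matrix.mul_neg, neg_neg, smul_mul_smul_comm, Matrix.smul_mul, Matrix.mul_smul, smul_smul,
    one_mul, hX, hsq, show (1 / n * σ) * (1 / n * σ) = (σ ^ 2 / n) * (1 / (n : ℝ)) by ring, mul_smul, hG, ridgeCov]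
  set A := regGram lam (1 / n) Finset.univ x
  have hAA : A⁻¹ * A = 1 := Matrix.nonsing_inv_mul _ (hA.isUnit_det hlam)
  simp only [mul_add, add_mul, mul_sub, sub_mul, smul_sub, mul_smul_comm, smul_mul_assoc, one_mul,
    ← mul_assoc, hAA, sub_smul]
  rw [smul_smul]
  ring_nf
  abel

/-- Given the covariates, the excess test error of the ridge estimator concentrates around the
trace of its conditional covariance. -/
lemma lintegral_ridgeRisk_sub_trace_le {lam : ℝ} (hlam : 0 < lam) (σ : ℝ≥0)
    (x : Fin n → EuclideanSpace ℝ (Fin d)) :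
    ∫⁻ w, ENNReal.ofReal ((ridgeRisk lam (1 / n) w.1 x w.2 -
        (ridgeCov (lam ^ 2 / d - σ ^ 2 * lam / n) (σ ^ 2 / n)
          (regGram lam (1 / n) Finset.univ x)).trace) ^ 2)
      ∂((multivariateGaussian 0 ((d : ℝ)⁻¹ • (1 : Matrix (Fin d) (Fin d) ℝ))).prod
        (Measure.pi fun _ : Fin n => gaussianReal 0 (σ ^ 2))) ≤
      ENNReal.ofReal (gaussianSqVar * (2 * (lam ^ 2 / d - σ ^ 2 * lam / n) ^ 2 * (d / lam ^ 4) +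
        2 * (σ ^ 2 / n) ^ 2 * (d / lam ^ 2))) := by
  have hA := isCoerciveMatrix_regGram lam (c := 1 / n) (by positivity) Finset.univ x
  have hTT := ridgeErrorMatrix_mul_transpose hlam (σ : ℝ) x
  set T := ridgeErrorMatrix lam (σ : ℝ) x with hT
  have hM : (Tᵀ * T).IsHermitian := by
    simp [Matrix.IsHermitian]
  have hq := lintegral_quadForm_stdGaussian hM
  rw [← map_pi_eq_stdGaussian, lintegral_map (by
      have : Continuous fun v : EuclideanSpace ℝ (Fin d ⊕ Fin n) =>
        (v.ofLp ⬝ᵥ (Tᵀ * T) *ᵥ v.ofLp - (Tᵀ * T).trace) ^ 2 := by fun_prop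
      exact this.measurable.ennreal_ofReal) (by fun_prop)] at hq
  have hcont : Continuous fun w : EuclideanSpace ℝ (Fin d) × (Fin n → ℝ) =>
      ridgeRisk lam (1 / n) w.1 x w.2 := by
    unfold ridgeRisk ridgeSource
    fun_prop
  have hmeas : ∀ t : ℝ, Measurable fun w : EuclideanSpace ℝ (Fin d) × (Fin n → ℝ) =>
      ENNReal.ofReal ((ridgeRisk lam (1 / n) w.1 x w.2 - t) ^ 2) := fun t =>
    ((hcont.sub continuous_const).pow 2).measurable.ennreal_ofReal
  rw [← (measurePreserving_signal_noise d n σ).lintegral_comp (hmeas _)]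
  have htr : (Tᵀ * T).trace = (T * Tᵀ).trace := Matrix.trace_mul_comm _ _
  -- Cyclicity moves the variance from size d + n to the d × d matrix TTᵀ, whose resolvent form is
  -- known.
  have htr2 : (Tᵀ * T * (Tᵀ * T)).trace = (T * Tᵀ * (T * Tᵀ)).trace := by
    rw [Matrix.mul_assoc, Matrix.trace_mul_comm]
    simp only [Matrix.mul_assoc]
  rw [htr2, hTT] at hq
  refine le_trans (le_of_eq ?_) (hq.le.trans (ENNReal.ofReal_le_ofReal
    (mul_le_mul_of_nonneg_left (hA.trace_ridgeCov_sq_le hlam _ _) gaussianSqVar_nonneg))) |>.trans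
    (by simp)
  refine lintegral_congr fun z => ?_
  rw [htr, hTT, ← Matrix.mulVec_mulVec, Matrix.dotProduct_mulVec, Matrix.vecMul_transpose, hT,
    ridgeErrorMatrix_mulVec, ridgeRisk]

end ConditionalRisk

/-! ### Calculus of convergence in probability -/

namespace TendstoInProbabilityConst

variable {Ω : ℕ → Type*} [∀ k, MeasurableSpace (Ω k)] {P : ∀ k, Measure (Ω k)}
  {Z W : ∀ k, Ω k → ℝ} {c e : ℝ}

/-- The approximation error is uniform in k and ω, so the step of a difference quotient can stay
fixed while k tends to infinity. -/
lemma of_forall_approx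
    (h : ∀ η : ℝ, 0 < η → ∃ (Z' : ∀ k, Ω k → ℝ) (c' : ℝ), TendstoInProbabilityConst P Z' c' ∧
      (∀ k ω, |Z k ω - Z' k ω| ≤ η) ∧ |c - c'| ≤ η) :
    TendstoInProbabilityConst P Z c := by
  intro δ hδ
  obtain ⟨Z', c', hZ', hZ, hc⟩ := h (δ / 4) (by positivity)
  refine tendsto_of_tendsto_of_tendsto_of_le_of_le tendsto_const_nhds (hZ' (δ / 2) (by positivity))
    (fun k => zero_le) fun k => measure_mono fun ω hω => ?_
  simp only [Set.mem_ofPred_eq] at hω ⊢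
  have h1 := hZ k ω
  have h2 : Z k ω - c = (Z k ω - Z' k ω) + (Z' k ω - c') + (c' - c) := by ring
  rw [h2] at hω
  have h3 := abs_add_three (Z k ω - Z' k ω) (Z' k ω - c') (c' - c)
  rw [abs_sub_comm c' c] at h3
  linarith

lemma add (hZ : TendstoInProbabilityConst P Z c) (hW : TendstoInProbabilityConst P W e) :
    TendstoInProbabilityConst P (fun k ω => Z k ω + W k ω) (c + e) := by
  intro δ hδ
  have h := (hZ (δ / 2) (by positivity)).add (hW (δ / 2) (by positivity))
  rw [add_zero] at h
  refine tendsto_of_tendsto_of_tendsto_of_le_of_le tendsto_const_nhds h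
    (fun k => zero_le) fun k => (measure_mono fun ω hω => ?_).trans (measure_union_le _ _)
  simp only [Set.mem_ofPred_eq, Set.mem_union] at hω ⊢
  by_contra! hcon
  have h3 := abs_add_le (Z k ω - c) (W k ω - e)
  rw [add_sub_add_comm] at hω
  linarith

lemma mul_seq {a : ℕ → ℝ} {a₀ : ℝ} (ha : Tendsto a atTop (𝓝 a₀))
    (hZ : TendstoInProbabilityConst P Z c) :
    TendstoInProbabilityConst P (fun k ω => a k * Z k ω) (a₀ * c) := by
  intro δ hδ
  have hpos : 0 < |a₀| + 1 := by positivity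
  have h1 : ∀ᶠ k in atTop, |a k| < |a₀| + 1 := ha.abs.eventually_lt_const (by linarith)
  have h2 : ∀ᶠ k in atTop, |a k * c - a₀ * c| < δ / 2 := by
    have := ((ha.mul_const c).sub_const (a₀ * c)).abs
    rw [sub_self, abs_zero] at this
    exact this.eventually_lt_const (by positivity)
  refine tendsto_of_tendsto_of_tendsto_of_le_of_le' tendsto_const_nhds
    (hZ (δ / (2 * (|a₀| + 1))) (by positivity)) (Eventually.of_forall fun k => zero_le) ?_
  filter_upwards [h1, h2] with k hk1 hk2
  refine measure_mono fun ω hω => ?_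
  simp only [Set.mem_ofPred_eq] at hω ⊢
  have h3 := abs_add_le (a k * (Z k ω - c)) (a k * c - a₀ * c)
  rw [show a k * (Z k ω - c) + (a k * c - a₀ * c) = a k * Z k ω - a₀ * c by ring, abs_mul] at h3
  have h4 := mul_le_mul_of_nonneg_right hk1.le (abs_nonneg (Z k ω - c))
  rw [div_le_iff₀ (by positivity)]
  linarith

lemma congr_ae (h : ∀ k, Z k =ᵐ[P k] W k) (hW : TendstoInProbabilityConst P W c) :
    TendstoInProbabilityConst P Z c := by
  intro δ hδ
  refine (hW δ hδ).congr fun k => measure_congr ?_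
  filter_upwards [h k] with ω hω
  exact propext (by change δ ≤ |W k ω - c| ↔ δ ≤ |Z k ω - c|; rw [hω])

/-- Chebyshev's inequality: mean square convergence implies convergence in probability. -/
lemma of_lintegral_sq {a b : ℕ → ℝ} (hm : ∀ k, Measurable (Z k)) (ha : Tendsto a atTop (𝓝 c))
    (hb : Tendsto b atTop (𝓝 0))
    (h : ∀ᶠ k in atTop, ∫⁻ ω, ENNReal.ofReal ((Z k ω - a k) ^ 2) ∂(P k) ≤ ENNReal.ofReal (b k)) :
    TendstoInProbabilityConst P Z c := by
  intro δ hδ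
  have hb' : Tendsto (fun k => ENNReal.ofReal (b k / (δ / 2) ^ 2)) atTop (𝓝 0) := by
    have := (ENNReal.tendsto_ofReal (hb.div_const ((δ / 2) ^ 2)))
    simpa using this
  refine tendsto_of_tendsto_of_tendsto_of_le_of_le' tendsto_const_nhds hb'
    (Eventually.of_forall fun k => zero_le) ?_
  have ha' : ∀ᶠ k in atTop, |a k - c| < δ / 2 := by
    have := (ha.sub_const c).abs
    rw [sub_self, abs_zero] at this
    exact this.eventually_lt_const (by positivity)
  filter_upwards [h, ha'] with k hk hak
  have hδ2 : 0 < (δ / 2) ^ 2 := by positivity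
  have hmarkov := mul_meas_ge_le_lintegral₀ (μ := P k)
    (f := fun ω => ENNReal.ofReal ((Z k ω - a k) ^ 2))
    ((((hm k).sub_const _).pow_const 2).ennreal_ofReal.aemeasurable) (ENNReal.ofReal ((δ / 2) ^ 2))
  have hsub : {ω | δ ≤ |Z k ω - c|} ⊆
      {ω | ENNReal.ofReal ((δ / 2) ^ 2) ≤ ENNReal.ofReal ((Z k ω - a k) ^ 2)} := fun ω hω => by
    simp only [Set.mem_ofPred_eq] at hω ⊢
    refine ENNReal.ofReal_le_ofReal ?_
    rw [← sq_abs (Z k ω - a k)]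
    refine pow_le_pow_left₀ (by positivity) ?_ 2
    have := abs_sub_le (Z k ω) (a k) c
    linarith
  rw [ENNReal.ofReal_div_of_pos hδ2, ENNReal.le_div_iff_mul_le
    (Or.inl (ENNReal.ofReal_pos.2 hδ2).ne') (Or.inl ENNReal.ofReal_ne_top), mul_comm]
  exact (mul_le_mul_right (measure_mono hsub) _).trans (hmarkov.trans hk)

lemma comp_hasLaw {E : ℕ → Type*} [∀ k, MeasurableSpace (E k)] {μ : ∀ k, Measure (E k)}
    {F : ∀ k, E k → ℝ} {X : ∀ k, Ω k → E k} (hX : ∀ k, HasLaw (X k) (μ k) (P k))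
    (hF : ∀ k, Measurable (F k)) (h : TendstoInProbabilityConst μ F c) :
    TendstoInProbabilityConst P (fun k ω => F k (X k ω)) c := by
  intro δ hδ
  refine (h δ hδ).congr fun k => ((hX k).measure_eq (p := fun z => δ ≤ |F k z - c|) ?_).symm
  exact measurableSet_le measurable_const ((hF k).sub_const c).abs

lemma const (c : ℝ) : TendstoInProbabilityConst P (fun _ _ => c) c := by
  intro δ hδ
  simp [hδ.not_ge]

end TendstoInProbabilityConst

/-! ### Limits of the traces and of the risk -/

section Limits

open scoped Matrix

variable {d n : ℕ → ℕ} {γ lam : ℝ}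

lemma continuous_trace_inv_regGram {κ ι : Type*} [Fintype κ] [DecidableEq κ] [Fintype ι]
    {lam : ℝ} (hlam : 0 < lam) {c : ℝ} (hc : 0 ≤ c) :
    Continuous fun x : ι → EuclideanSpace ℝ κ => (regGram lam c Finset.univ x)⁻¹.trace :=
  (continuous_regGram_inv hlam hc Finset.univ).matrix_trace

/-- Convergence of the normalized trace of the resolvent of a sample covariance matrix. -/
lemma tendstoInProbabilityConst_trace_inv (hγ : 0 < γ) (hlam : 0 < lam)
    (hd : Tendsto d atTop atTop) (hn : Tendsto n atTop atTop)
    (hdn : Tendsto (fun k => (d k : ℝ) / (n k : ℝ)) atTop (𝓝 γ)) :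
    TendstoInProbabilityConst
      (fun k => Measure.pi fun _ : Fin (n k) => stdGaussian (EuclideanSpace ℝ (Fin (d k))))
      (fun k x => (regGram lam (1 / n k) Finset.univ x)⁻¹.trace / d k) (mpRoot lam γ) := by
  have hd' : Tendsto (fun k => (d k : ℝ)) atTop atTop := tendsto_natCast_atTop_atTop.comp hd
  -- The mean square rate is centred at the finite-size ratio d/n; continuity in the ratio then
  -- moves the centre to γ.
  refine TendstoInProbabilityConst.of_lintegral_sq (a := fun k => mpRoot lam (d k / n k))
    (b := fun k => 2 / ((d k : ℝ) ^ 2 * lam ^ 4) + 2 * gaussianSqVar / (d k * lam ^ 4))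
    (fun k => ((continuous_trace_inv_regGram hlam (by positivity)).div_const _).measurable)
    ((continuousAt_mpRoot hlam hγ).tendsto.comp hdn) ?_ ?_
  · have h4 : 0 < lam ^ 4 := by positivity
    have h1 := (((tendsto_pow_atTop two_ne_zero).comp hd').atTop_mul_const h4).const_div_atTop 2
    have h2 := (hd'.atTop_mul_const h4).const_div_atTop (2 * gaussianSqVar)
    simpa using h1.add h2
  · filter_upwards [hd.eventually_ge_atTop 1, hn.eventually_ge_atTop 1] with k hk1 hk2
    have : Nonempty (Fin (d k)) := ⟨⟨0, hk1⟩⟩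
    have : Nonempty (Fin (n k)) := ⟨⟨0, hk2⟩⟩
    simpa using lintegral_resolvent_sub_mpRoot_le (ι := Fin (n k)) (κ := Fin (d k)) hlam

/-- Convergence of the normalized trace of the squared resolvent. -/
lemma tendstoInProbabilityConst_trace_inv_sq (hγ : 0 < γ) (hlam : 0 < lam)
    (hd : Tendsto d atTop atTop) (hn : Tendsto n atTop atTop)
    (hdn : Tendsto (fun k => (d k : ℝ) / (n k : ℝ)) atTop (𝓝 γ)) :
    TendstoInProbabilityConst
      (fun k => Measure.pi fun _ : Fin (n k) => stdGaussian (EuclideanSpace ℝ (Fin (d k))))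
      (fun k x => ((regGram lam (1 / n k) Finset.univ x)⁻¹ *
        (regGram lam (1 / n k) Finset.univ x)⁻¹).trace / d k)
      (-deriv (fun l => mpRoot l γ) lam) := by
  refine TendstoInProbabilityConst.of_forall_approx fun η hη => ?_
  have hslope := (differentiableAt_mpRoot hlam hγ).hasDerivAt.tendsto_slope_zero_right
  have h1 : ∀ᶠ h in 𝓝[>] (0 : ℝ), |deriv (fun l => mpRoot l γ) lam -
      h⁻¹ • (mpRoot (lam + h) γ - mpRoot lam γ)| < η := by
    have := (hslope.const_sub (deriv (fun l => mpRoot l γ) lam)).abs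
    rw [sub_self, abs_zero] at this
    exact this.eventually_lt_const hη
  have h2 : ∀ᶠ h in 𝓝[>] (0 : ℝ), h < η * lam ^ 3 :=
    (tendsto_id.mono_left nhdsWithin_le_nhds).eventually_lt_const (by positivity)
  -- One step h serves twice: the slope of `mpRoot` is within η of its derivative, and the matrix
  -- error h/λ³ is below η.
  obtain ⟨h, hh1, hh2, hh0⟩ := (h1.and (h2.and self_mem_nhdsWithin)).exists
  have hh0 : 0 < h := hh0
  have hA := tendstoInProbabilityConst_trace_inv hγ hlam hd hn hdn
  have hB := tendstoInProbabilityConst_trace_inv hγ (by positivity : 0 < lam + h) hd hn hdn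
  have hAB := (hA.mul_seq (tendsto_const_nhds (x := 1 / h))).add
    (hB.mul_seq (tendsto_const_nhds (x := -(1 / h))))
  refine ⟨_, _, hAB, fun k x => ?_, ?_⟩
  · have hc := isCoerciveMatrix_regGram lam (c := 1 / n k) (by positivity) Finset.univ x
    have hle := hc.abs_trace_inv_sq_sub_le hlam hh0
    rw [regGram_add_smul_one, Fintype.card_fin] at hle
    have hdd : (0 : ℝ) ≤ d k := by positivity
    have hdiv := div_le_div_of_nonneg_right hle hdd
    rw [← abs_of_nonneg hdd, ← abs_div, abs_of_nonneg hdd] at hdiv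
    calc _ = _ := by congr 1; ring
      _ ≤ _ := hdiv
      _ = h / lam ^ 3 * ((d k : ℝ) / d k) := by ring
      _ ≤ h / lam ^ 3 * 1 := by gcongr; exact div_self_le_one _
      _ ≤ η := by rw [mul_one, div_le_iff₀ (by positivity)]; exact hh2.le
  · rw [smul_eq_mul] at hh1
    rw [← abs_neg]
    refine le_of_eq_of_le ?_ hh1.le
    congr 1
    field_simp
    ring

lemma continuous_ridgeRisk {κ ι : Type*} [Fintype κ] [DecidableEq κ] [Fintype ι]
    {lam c : ℝ} (hlam : 0 < lam) (hc : 0 ≤ c) :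
    Continuous fun z : EuclideanSpace ℝ κ × (ι → EuclideanSpace ℝ κ) × (ι → ℝ) =>
      ridgeRisk lam c z.1 z.2.1 z.2.2 := by
  have h : Continuous fun z : EuclideanSpace ℝ κ × (ι → EuclideanSpace ℝ κ) × (ι → ℝ) =>
      (regGram lam c Finset.univ z.2.1)⁻¹ :=
    (continuous_regGram_inv hlam hc Finset.univ).comp (by fun_prop)
  unfold ridgeRisk ridgeSource
  fun_prop

/-- Puts the covariates outermost, so that a bound conditional on them can be integrated. -/
lemma lintegral_teacherLaw (d n : ℕ) (σ : ℝ≥0)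
    {F : EuclideanSpace ℝ (Fin d) × (Fin n → EuclideanSpace ℝ (Fin d)) × (Fin n → ℝ) → ENNReal}
    (hF : Measurable F) :
    ∫⁻ z, F z ∂(teacherLaw d n σ) = ∫⁻ x, ∫⁻ w, F (w.1, x, w.2)
      ∂((multivariateGaussian 0 ((d : ℝ)⁻¹ • (1 : Matrix (Fin d) (Fin d) ℝ))).prod
        (Measure.pi fun _ : Fin n => gaussianReal 0 (σ ^ 2)))
      ∂(Measure.pi fun _ : Fin n => stdGaussian (EuclideanSpace ℝ (Fin d))) := by
  rw [teacherLaw, lintegral_prod _ hF.aemeasurable]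
  have h1 : ∀ β, ∫⁻ y, F (β, y) ∂((Measure.pi fun _ : Fin n =>
      stdGaussian (EuclideanSpace ℝ (Fin d))).prod
      (Measure.pi fun _ : Fin n => gaussianReal 0 (σ ^ 2))) =
      ∫⁻ x, ∫⁻ e, F (β, x, e) ∂(Measure.pi fun _ : Fin n => gaussianReal 0 (σ ^ 2))
        ∂(Measure.pi fun _ : Fin n => stdGaussian (EuclideanSpace ℝ (Fin d))) := fun β =>
    lintegral_prod _ (by fun_prop)
  simp_rw [h1]
  rw [lintegral_lintegral_swap]
  · refine lintegral_congr fun x => ?_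
    rw [lintegral_prod _ (by fun_prop)]
  · refine Measurable.aemeasurable ?_
    exact Measurable.lintegral_prod_right'
      (f := fun q : (EuclideanSpace ℝ (Fin d) × (Fin n → EuclideanSpace ℝ (Fin d))) × (Fin n → ℝ) =>
        F (q.1.1, q.1.2, q.2)) (by fun_prop)

lemma continuous_trace_ridgeCov {κ ι : Type*} [Fintype κ] [DecidableEq κ] [Fintype ι]
    {lam : ℝ} (hlam : 0 < lam) {c : ℝ} (hc : 0 ≤ c) (c₁ c₂ : ℝ) :
    Continuous fun x : ι → EuclideanSpace ℝ κ =>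
      (ridgeCov c₁ c₂ (regGram lam c Finset.univ x)).trace := by
  have := continuous_regGram_inv (κ := κ) hlam hc (Finset.univ : Finset ι)
  unfold ridgeCov
  fun_prop

/-- The excess test error minus its conditional mean tends to zero in probability. -/
lemma tendstoInProbabilityConst_ridgeRisk_sub (hlam : 0 < lam) (σ : ℝ≥0)
    (hd : Tendsto d atTop atTop)
    (hdn : Tendsto (fun k => (d k : ℝ) / (n k : ℝ)) atTop (𝓝 γ)) :
    TendstoInProbabilityConst (fun k => teacherLaw (d k) (n k) σ)
      (fun k z => ridgeRisk lam (1 / n k) z.1 z.2.1 z.2.2 -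
        (ridgeCov (lam ^ 2 / d k - σ ^ 2 * lam / n k) (σ ^ 2 / n k)
          (regGram lam (1 / n k) Finset.univ z.2.1)).trace) 0 := by
  have hd' : Tendsto (fun k => (d k : ℝ)) atTop atTop := tendsto_natCast_atTop_atTop.comp hd
  have hmeas : ∀ k, Measurable fun z : EuclideanSpace ℝ (Fin (d k)) ×
      (Fin (n k) → EuclideanSpace ℝ (Fin (d k))) × (Fin (n k) → ℝ) =>
      ridgeRisk lam (1 / n k) z.1 z.2.1 z.2.2 -
        (ridgeCov (lam ^ 2 / d k - σ ^ 2 * lam / n k) (σ ^ 2 / n k)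
          (regGram lam (1 / n k) Finset.univ z.2.1)).trace := fun k =>
    ((continuous_ridgeRisk hlam (by positivity)).sub
      ((continuous_trace_ridgeCov hlam (by positivity) _ _).comp (by fun_prop))).measurable
  refine TendstoInProbabilityConst.of_lintegral_sq (a := fun _ => 0)
    (b := fun k => gaussianSqVar * (2 * (lam ^ 2 / d k - σ ^ 2 * lam / n k) ^ 2 *
      (d k / lam ^ 4) + 2 * (σ ^ 2 / n k) ^ 2 * (d k / lam ^ 2)))
    hmeas tendsto_const_nhds ?_ (Eventually.of_forall fun k => ?_)
  · have h1 : Tendsto (fun k => gaussianSqVar *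
        (2 * (lam ^ 2 - σ ^ 2 * lam * ((d k : ℝ) / n k)) ^ 2 / lam ^ 4 +
          2 * (σ ^ 2 * ((d k : ℝ) / n k)) ^ 2 / lam ^ 2) / d k) atTop (𝓝 0) := by
      refine Tendsto.div_atTop (a := gaussianSqVar *
        (2 * (lam ^ 2 - σ ^ 2 * lam * γ) ^ 2 / lam ^ 4 + 2 * (σ ^ 2 * γ) ^ 2 / lam ^ 2)) ?_ hd'
      refine Tendsto.const_mul _ (Tendsto.add ?_ ?_)
      · exact (((hdn.const_mul _).const_sub _).pow 2 |>.const_mul 2).div_const _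
      · exact ((hdn.const_mul _).pow 2 |>.const_mul 2).div_const _
    refine h1.congr' ?_
    filter_upwards [hd.eventually_ge_atTop 1] with k hk
    have : (0 : ℝ) < d k := by exact_mod_cast hk
    rcases eq_or_ne (n k : ℝ) 0 with h0 | h0
    · rw [h0]; field_simp
    · field_simp
  · rw [lintegral_teacherLaw _ _ _ (((hmeas k).sub_const 0).pow_const 2).ennreal_ofReal]
    simp only [sub_zero]
    refine (lintegral_mono fun x => lintegral_ridgeRisk_sub_trace_le hlam σ x).trans ?_
    simp

end Limits

lemma measurePreserving_teacherLaw_covariates (d n : ℕ) (σ : ℝ≥0) :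
    MeasurePreserving (fun z : EuclideanSpace ℝ (Fin d) ×
        (Fin n → EuclideanSpace ℝ (Fin d)) × (Fin n → ℝ) => z.2.1) (teacherLaw d n σ)
      (Measure.pi fun _ : Fin n => stdGaussian (EuclideanSpace ℝ (Fin d))) :=
  measurePreserving_fst.comp measurePreserving_snd

/-- Convergence in probability of the excess test error of ridge regression. -/
lemma tendstoInProbabilityConst_ridgeRisk {d n : ℕ → ℕ} {γ lam : ℝ} (hγ : 0 < γ) (hlam : 0 < lam)
    (σ : ℝ≥0) (hd : Tendsto d atTop atTop) (hn : Tendsto n atTop atTop)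
    (hdn : Tendsto (fun k => (d k : ℝ) / (n k : ℝ)) atTop (𝓝 γ)) :
    TendstoInProbabilityConst (fun k => teacherLaw (d k) (n k) σ)
      (fun k z => ridgeRisk lam (1 / n k) z.1 z.2.1 z.2.2)
      ((lam ^ 2 - σ ^ 2 * lam * γ) * -deriv (fun l => mpRoot l γ) lam +
        σ ^ 2 * γ * mpRoot lam γ) := by
  have h1 := (tendstoInProbabilityConst_trace_inv hγ hlam hd hn hdn).comp_hasLaw
    (fun k => (measurePreserving_teacherLaw_covariates (d k) (n k) σ).hasLaw)
    (fun k => ((continuous_trace_inv_regGram hlam (by positivity)).div_const _).measurable)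
  have h2 := (tendstoInProbabilityConst_trace_inv_sq hγ hlam hd hn hdn).comp_hasLaw
    (fun k => (measurePreserving_teacherLaw_covariates (d k) (n k) σ).hasLaw)
    (fun k => (((continuous_regGram_inv hlam (by positivity) Finset.univ).mul
      (continuous_regGram_inv hlam (by positivity) Finset.univ)).matrix_trace.div_const
        _).measurable)
  -- These coefficients are d times those of A⁻² and A⁻¹ in the conditional covariance, matching
  -- traces normalized by d.
  have h3 := (h2.mul_seq ((hdn.const_mul ((σ : ℝ) ^ 2 * lam)).const_sub (lam ^ 2))).add
    (h1.mul_seq (hdn.const_mul ((σ : ℝ) ^ 2)))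
  have h4 := (tendstoInProbabilityConst_ridgeRisk_sub hlam σ hd hdn).add h3
  rw [zero_add] at h4
  intro δ hδ
  refine (h4 δ hδ).congr' ?_
  filter_upwards [hd.eventually_ge_atTop 1] with k hk
  have hdk : (d k : ℝ) ≠ 0 := by positivity
  congr 1
  ext z
  have : ridgeRisk lam (1 / n k) z.1 z.2.1 z.2.2 -
        (ridgeCov (lam ^ 2 / d k - σ ^ 2 * lam / n k) (σ ^ 2 / n k)
          (regGram lam (1 / n k) Finset.univ z.2.1)).trace +
      ((lam ^ 2 - σ ^ 2 * lam * ((d k : ℝ) / n k)) *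
        (((regGram lam (1 / n k) Finset.univ z.2.1)⁻¹ *
          (regGram lam (1 / n k) Finset.univ z.2.1)⁻¹).trace / d k) +
        σ ^ 2 * ((d k : ℝ) / n k) * ((regGram lam (1 / n k) Finset.univ z.2.1)⁻¹.trace / d k)) =
      ridgeRisk lam (1 / n k) z.1 z.2.1 z.2.2 := by
    rw [ridgeCov, Matrix.trace_add, Matrix.trace_smul, Matrix.trace_smul, smul_eq_mul, smul_eq_mul]
    rcases eq_or_ne (n k : ℝ) 0 with h0 | h0
    · rw [h0]
      simp
      field_simp
      ring
    · field_simp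
      ring
  simp only [Set.mem_ofPred_eq, Pi.mul_apply]
  rw [this]

theorem mainTheorem6 (γ lam : ℝ) (hγ : 0 < γ) (hlam : 0 < lam) (σ : ℝ≥0)
    (d n : ℕ → ℕ) (hd : Tendsto d atTop atTop) (hn : Tendsto n atTop atTop)
    (hdn : Tendsto (fun k => (d k : ℝ) / (n k : ℝ)) atTop (𝓝 γ))
    {Ω : ℕ → Type*} [∀ k, MeasurableSpace (Ω k)]
    (P : ∀ k, Measure (Ω k)) [∀ k, IsProbabilityMeasure (P k)]
    (βstar : ∀ k, Ω k → EuclideanSpace ℝ (Fin (d k)))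
    (x : ∀ k, Ω k → Fin (n k) → EuclideanSpace ℝ (Fin (d k)))
    (ε : ∀ k, Ω k → Fin (n k) → ℝ)
    (hlaw : ∀ k, HasLaw (fun ω => (βstar k ω, x k ω, ε k ω)) (teacherLaw (d k) (n k) σ) (P k))
    (βhat : ∀ k, Ω k → EuclideanSpace ℝ (Fin (d k)))
    (hβhat : ∀ k, ∀ᵐ ω ∂(P k), IsMinOn
      (ridgeObjective lam (x k ω) (fun i => linearLabel (βstar k ω) (x k ω i) (ε k ω i)))
      Set.univ (βhat k ω)) :
    TendstoInProbabilityConst P (fun k ω => testError σ (βstar k ω) (βhat k ω))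
      ((σ : ℝ) ^ 2 + (lam - (σ : ℝ) ^ 2 * γ) * lam * mpStieltjesNegDeriv lam γ
        + (σ : ℝ) ^ 2 * γ * mpStieltjes lam γ) := by
  have h := (TendstoInProbabilityConst.const (P := P) ((σ : ℝ) ^ 2)).add
    ((tendstoInProbabilityConst_ridgeRisk hγ hlam σ hd hn hdn).comp_hasLaw hlaw
      fun k => (continuous_ridgeRisk hlam (by positivity)).measurable)
  rw [mpStieltjesNegDeriv_eq hlam hγ, mpStieltjes_eq_mpRoot hlam hγ]
  -- Almost surely the error is a measurable function of the data alone, so no measurability of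
  -- `βhat` is required.
  convert TendstoInProbabilityConst.congr_ae (fun k => ?_) h using 1
  · ring
  · filter_upwards [hβhat k] with ω hω
    rw [testError_eq, norm_sub_sq_eq_ridgeRisk hlam hω]
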